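/- Let $\mathfrak g$ be the Lie algebra of a compact Lie group, with an invariant inner product $\langle\cdot,\cdot\rangle$ (only the structure of a finite-dimensional real inner product space is used). Let $\Omega\subset\mathbb R^n$ be a bounded Lipschitz domain, and let $\mathcal T_h$ be a triangulation of $\overline\Omega$, i.e. the set of $n$-dimensional simplices $K$ of a finite simplicial complex in $\mathbb R^n$ with underlying space $\overline\Omega$. Exterior derivatives $d$ of $\mathfrak g$-valued forms are taken in the sense of distributions, $\langle(\alpha\otimes\xi)\wedge(\beta\otimes\eta)\rangle=\langle\xi,\eta\rangle\,\alpha\wedge\beta$, and $L^p\Lambda^k$ is the space of $\mathfrak g$-valued $k$-forms with $L^p$ coefficients (zero if $k<0$). Put \begin{align*} V^0&=\{\phi\in L^\infty\Lambda^0(\overline\Omega): d\phi\in L^4\Lambda^1(\overline\Omega)\}, & V^1&=\{A\in L^4\Lambda^1(\overline\Omega): dA\in L^2\Lambda^2(\overline\Omega)\},\\ DV^0&=\{\phi\in L^\infty\Lambda^0(\overline\Omega): d(\phi|_K)\in L^4\Lambda^1(K)\ \forall K\in\mathcal T_h\}, & DV^1&=\{A\in L^4\Lambda^1(\overline\Omega):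 d(A|_K)\in L^2\Lambda^2(K)\ \forall K\in\mathcal T_h\},\\ \widehat V^{n-1}&=\{\widehat D\in L^{4/3}\Lambda^{n-1}(\overline\Omega): d\widehat D\in L^1\Lambda^n(\overline\Omega)\}, & \widehat V^{n-2}&=\{\widehat H\in L^2\Lambda^{n-2}(\overline\Omega): d\widehat H\in L^{4/3}\Lambda^{n-1}(\overline\Omega)\}. \end{align*} For a $k$-form $u$ and an $(n-k-1)$-form $\lambda$ on $M$ ($M=K$ or $M=\overline\Omega$) for which the right-hand side makes sense, put $$\int_{\partial M}\langle u\wedge\lambda\rangle:=\int_M\bigl(\langle du\wedge\lambda\rangle+(-1)^k\langle u\wedge d\lambda\rangle\bigr).$$ Let $\mathring V^k$ ($k=0,1$) be the set of $u\in V^k$ whose tangential trace on $\partial\Omega$ vanishes, that is, $\int_{\partial\overline\Omega}\langle u\wedge\lambda\rangle=0$ for all $(n-k-1)$-forms $\lambda$ that are smooth up to the boundary (restrictions to $\overline\Omega$ of $C^\infty$ forms on $\mathbb R^n$). Then: (i) for every $\phi\in DV^0$, we have $\phi\in\mathring V^0$ if and only if $\sum_{K\in\mathcal T_h}\int_{\partial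 K}\langle\phi,\widehat D\rangle=0$ for all $\widehat D\in\widehat V^{n-1}$; (ii) for every $A\in DV^1$, we have $A\in\mathring V^1$ if and only if $\sum_{K\in\mathcal T_h}\int_{\partial K}\langle A\wedge\widehat H\rangle=0$ for all $\widehat H\in\widehat V^{n-2}$. -/

import Mathlib

open MeasureTheory

noncomputable section

namespace YangMills

/-- Euclidean space `ℝⁿ` with its standard norm and Lebesgue measure. -/
abbrev Space (n : ℕ) : Type := EuclideanSpace ℝ (Fin n)

/-- Alternating `k`-covectors on `ℝⁿ` with values in `𝔤`, i.e. `⋀ᵏ(ℝⁿ)* ⊗ 𝔤`. -/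
abbrev Covector (n k : ℕ) (𝔤 : Type*) [NormedAddCommGroup 𝔤] [InnerProductSpace ℝ 𝔤] : Type _ :=
  Space n [⋀^Fin k]→L[ℝ] 𝔤

/-- `𝔤`-valued `k`-forms. Everything below only depends on a form up to equality almost everywhere
on the open set under consideration. -/
abbrev Form (n k : ℕ) (𝔤 : Type*) [NormedAddCommGroup 𝔤] [InnerProductSpace ℝ 𝔤] : Type _ :=
  Space n → Covector n k 𝔤

/-- A bounded Lipschitz domain: a bounded connected open set that near each of its boundary points
is, in suitable Cartesian coordinates, the set of points above the graph of a Lipschitz function.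
Here `ν` is the unit vector of the vertical axis and `γ` is a function on the hyperplane `ν^⊥`. -/
structure IsLipschitzDomain {n : ℕ} (Ω : Set (Space n)) : Prop where
  isOpen : IsOpen Ω
  isConnected : IsConnected Ω
  isBounded : Bornology.IsBounded Ω
  lipschitz_boundary : ∀ x ∈ frontier Ω, ∃ (ν : Space n) (r : ℝ) (L : NNReal)
    (γ : (ℝ ∙ ν)ᗮ → ℝ), ‖ν‖ = 1 ∧ 0 < r ∧ LipschitzWith L γ ∧
      ∀ y ∈ Metric.ball x r, y ∈ Ω ↔ γ ((ℝ ∙ ν)ᗮ.orthogonalProjectionOnto y) < inner ℝ ν y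

/-- A triangulation of `closure Ω`: a finite (geometric) simplicial complex whose underlying space
is `closure Ω`. -/
structure Triangulation {n : ℕ} (Ω : Set (Space n))
    extends Geometry.SimplicialComplex ℝ (Space n) where
  finite_faces : faces.Finite
  space_eq : toSimplicialComplex.space = closure Ω

/-- The (vertex sets of the) elements of the triangulation, i.e. of its `n`-dimensional simplices.
-/
def Triangulation.cells {n : ℕ} {Ω : Set (Space n)} (T : Triangulation Ω) :
    Finset (Finset (Space n)) :=
  T.finite_faces.toFinset.filter (fun s => s.card = n + 1)

/-- The interior of the closed simplex `K` with vertex set `s`. (The boundary of `K` is a null set,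
so that integrating over `K` or over its interior is the same, and so are `L^p(K)` and `L^p` of the
interior.) -/
def cellInterior {n : ℕ} (s : Finset (Space n)) : Set (Space n) :=
  interior (convexHull ℝ (s : Set (Space n)))

section Forms

variable {n k l m : ℕ} {𝔤 : Type*} [NormedAddCommGroup 𝔤] [InnerProductSpace ℝ 𝔤]

/-- The real-valued exterior product `⟨u ∧ v⟩`, with
`⟨(α ⊗ ξ) ∧ (β ⊗ η)⟩ = ⟨ξ, η⟩ (α ∧ β)`: the exterior product with values in `𝔤 ⊗ 𝔤`
(sum over shuffles), followed by the inner product `𝔤 ⊗ 𝔤 → ℝ`. -/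
def wedgeInner (u : Covector n k 𝔤) (v : Covector n l 𝔤) : Space n [⋀^Fin (k + l)]→ₗ[ℝ] ℝ :=
  ((TensorProduct.lift (innerₗ 𝔤)).compAlternatingMap
    (u.toAlternatingMap.domCoprod v.toAlternatingMap)).domDomCongr finSumFinEquiv

/-- For `k + l = n`, the coefficient of the `n`-covector `⟨u ∧ v⟩` with respect to the standard
volume form `dx¹ ∧ ⋯ ∧ dxⁿ`. -/
def wedgeCoeff (h : k + l = n) (u : Covector n k 𝔤) (v : Covector n l 𝔤) : ℝ :=
  wedgeInner u v (fun i => EuclideanSpace.basisFun (Fin n) ℝ (Fin.cast h i))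

/-- `w = du` on the open set `U` in the sense of distributions: `u`, `w` are locally integrable on
`U` and `∫_U ⟨w ∧ η⟩ = (-1)^(k+1) ∫_U ⟨u ∧ dη⟩` for all smooth `(n-k-1)`-forms `η` with compact
support in `U`. (If `k ≥ n` there are no such `η`, and `w` is an alternating `(k+1)`-form on `ℝⁿ`,
hence zero.) -/
def IsWeakExtDeriv (U : Set (Space n)) (u : Form n k 𝔤) (w : Form n (k + 1) 𝔤) : Prop :=
  LocallyIntegrableOn u U volume ∧ LocallyIntegrableOn w U volume ∧
    ∀ (m : ℕ) (h : k + m + 1 = n) (η : Form n m 𝔤),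
      ContDiff ℝ (⊤ : ℕ∞) η → HasCompactSupport η → tsupport η ⊆ U →
      ∫ x in U, wedgeCoeff (by omega) (w x) (η x) =
        (-1) ^ (k + 1) * ∫ x in U, wedgeCoeff (by omega) (u x) (extDeriv η x)

open Classical in
/-- The distributional exterior derivative of `u` on `U` (unique almost everywhere on the open set
`U`, if there is one that is a locally integrable form; otherwise the value is irrelevant). -/
def weakExtDeriv (U : Set (Space n)) (u : Form n k 𝔤) : Form n (k + 1) 𝔤 :=
  if h : ∃ w, IsWeakExtDeriv U u w then h.choose else 0

/-- The forms `u` on `U` with `u ∈ L^p` and `du ∈ L^q`. -/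
def WSpace (n k : ℕ) (𝔤 : Type*) [NormedAddCommGroup 𝔤] [InnerProductSpace ℝ 𝔤]
    (U : Set (Space n)) (p q : ENNReal) : Set (Form n k 𝔤) :=
  {u | MemLp u p (volume.restrict U) ∧
    ∃ w, IsWeakExtDeriv U u w ∧ MemLp w q (volume.restrict U)}

/-- The boundary integral `∫_{∂U} ⟨u ∧ μ⟩`, for a `k`-form `u` and an `(n-k-1)`-form `μ` of
sufficient regularity, defined by
`∫_{∂U} ⟨u ∧ μ⟩ = ∫_U (⟨du ∧ μ⟩ + (-1)^k ⟨u ∧ dμ⟩)`. -/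
def boundaryIntegral (h : k + m + 1 = n) (U : Set (Space n)) (u : Form n k 𝔤) (μ : Form n m 𝔤) :
    ℝ :=
  ∫ x in U, (wedgeCoeff (by omega) (weakExtDeriv U u x) (μ x) +
    (-1) ^ k * wedgeCoeff (by omega) (u x) (weakExtDeriv U μ x))

/-- The tangential trace of `u` on `∂Ω` vanishes. The tangential trace of a form of low regularity
is the functional `μ ↦ ∫_{∂Ω} ⟨u ∧ μ⟩` on the `(n-k-1)`-forms `μ` that are smooth up to the
boundary of `Ω`. -/
def HasZeroTangentialTrace (Ω : Set (Space n)) (u : Form n k 𝔤) : Prop :=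
  ∀ (m : ℕ) (h : k + m + 1 = n) (μ : Form n m 𝔤), ContDiff ℝ (⊤ : ℕ∞) μ →
    boundaryIntegral h Ω u μ = 0

end Forms

section Spaces

variable {n : ℕ} (𝔤 : Type*) [NormedAddCommGroup 𝔤] [InnerProductSpace ℝ 𝔤] (Ω : Set (Space n))

/-- `V⁰`: `φ ∈ L^∞` with `dφ ∈ L⁴`. -/
def V0 : Set (Form n 0 𝔤) := WSpace n 0 𝔤 Ω ⊤ 4

/-- `V¹`: `A ∈ L⁴` with `dA ∈ L²`. -/
def V1 : Set (Form n 1 𝔤) := WSpace n 1 𝔤 Ω 4 2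

/-- The forms in `V⁰` with vanishing trace. -/
def V0Ring : Set (Form n 0 𝔤) := {φ | φ ∈ V0 𝔤 Ω ∧ HasZeroTangentialTrace Ω φ}

/-- The forms in `V¹` with vanishing tangential trace. -/
def V1Ring : Set (Form n 1 𝔤) := {A | A ∈ V1 𝔤 Ω ∧ HasZeroTangentialTrace Ω A}

variable {Ω}

/-- `DV⁰`: `φ ∈ L^∞(Ω)` with `d(φ|_K) ∈ L⁴(K)` for all elements `K`. -/
def DV0 (T : Triangulation Ω) : Set (Form n 0 𝔤) :=
  {φ | MemLp φ ⊤ (volume.restrict Ω) ∧ ∀ s ∈ T.cells, ∃ w, IsWeakExtDeriv (cellInterior s) φ w ∧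
    MemLp w 4 (volume.restrict (cellInterior s))}

/-- `DV¹`: `A ∈ L⁴(Ω)` with `d(A|_K) ∈ L²(K)` for all elements `K`. -/
def DV1 (T : Triangulation Ω) : Set (Form n 1 𝔤) :=
  {A | MemLp A 4 (volume.restrict Ω) ∧ ∀ s ∈ T.cells, ∃ w, IsWeakExtDeriv (cellInterior s) A w ∧
    MemLp w 2 (volume.restrict (cellInterior s))}

variable (Ω)

/-- The Lagrange multipliers `D̂ ∈ L^{4/3}` with `dD̂ ∈ L¹`; used in degree `m = n - 1`. -/
def VHatD (m : ℕ) : Set (Form n m 𝔤) := WSpace n m 𝔤 Ω (4 / 3) 1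

/-- The Lagrange multipliers `Ĥ ∈ L²` with `dĤ ∈ L^{4/3}`; used in degree `m = n - 2`. -/
def VHatH (m : ℕ) : Set (Form n m 𝔤) := WSpace n m 𝔤 Ω 2 (4 / 3)

end Spaces

end YangMills

end

/-!
The elements of the triangulation are disjoint and cover `Ω` up to a null set, so the sum of their
boundary integrals is the integral over `Ω` of the Green density `⟨du ∧ D⟩ + (-1)ᵏ ⟨u ∧ dD⟩`, where
`du` is the elementwise derivative. If it vanishes for all multipliers `D`, then testing with smooth
forms `D` shows first that the elementwise derivative is the weak derivative of `u` on `Ω`, so that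
`u` is conforming, and then that its tangential trace vanishes.

Conversely, the extension by zero of a form with vanishing trace has a weak derivative on all of
`ℝⁿ`, namely the extension by zero of `du`. By a partition of unity, `u` may be supposed to be
supported in a region which is moved into `Ω` by small translations in some direction, transversal
to the boundary. Mollifiers concentrated near such a translation turn `u` into a test form on `Ω`,
so the integral of the Green density of `u` against a translate of `D` vanishes for all small
translations in this direction. It depends continuously on the translation by the duality of the
exponents, since one of any two conjugate exponents is finite, so it vanishes without translation.

The converse only uses that the two exterior derivatives are first order operators with constant
coefficients which are formally adjoint up to sign. For their symbols this is the identity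
`(ℓ ∧ u) ∧ D = (-1)ᵏ u ∧ (ℓ ∧ D)` for linear forms `ℓ`.
-/

namespace YangMills

section Geometry

open Metric Set Filter Topology

section SegmentProperty

variable {E : Type*} [AddCommGroup E] [Module ℝ E] [TopologicalSpace E] {U : Set E}

/-- The segment property of `U`: near each boundary point there is a direction `ν` such that all
small positive multiples of `ν` translate the closure of `U` into `U`. -/
def HasSegmentProperty (U : Set E) : Prop :=
  ∀ x ∈ frontier U, ∃ N ∈ 𝓝 x, ∃ ν : E,
    ∀ᶠ t in 𝓝[>] (0 : ℝ), MapsTo (fun y ↦ y + t • ν) (closure U ∩ N) U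

theorem HasSegmentProperty.exists_mapsTo_of_mem_closure (hseg : HasSegmentProperty U)
    (hU : IsOpen U) {x : E} (hx : x ∈ closure U) :
    ∃ N ∈ 𝓝 x, ∃ ν : E, ∀ᶠ t in 𝓝[>] (0 : ℝ), MapsTo (fun y ↦ y + t • ν) (closure U ∩ N) U := by
  by_cases hxU : x ∈ U
  · exact ⟨U, hU.mem_nhds hxU, 0, .of_forall fun t y hy ↦ by simpa using hy.2⟩
  · exact hseg x ⟨hx, by rwa [hU.interior_eq]⟩

variable [ContinuousAdd E] [ContinuousSMul ℝ E]

theorem tendsto_add_smul_nhdsGT (x ν : E) : Tendsto (fun t : ℝ ↦ x + t • ν) (𝓝[>] 0) (𝓝 x) := by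
  have h : Continuous fun t : ℝ ↦ x + t • ν := by fun_prop
  simpa using (h.tendsto 0).mono_left nhdsWithin_le_nhds

theorem HasSegmentProperty.interior_closure (hseg : HasSegmentProperty U) (hU : IsOpen U) :
    interior (closure U) = U := by
  refine Subset.antisymm (fun x hx ↦ ?_) (interior_maximal subset_closure hU)
  obtain ⟨N, hN, ν, hν⟩ := hseg.exists_mapsTo_of_mem_closure hU (interior_subset hx)
  have hback := (tendsto_add_smul_nhdsGT x (-ν)).eventually
    (inter_mem (mem_interior_iff_mem_nhds.1 hx) hN)
  obtain ⟨t, hmaps, hmem⟩ := (hν.and hback).exists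
  simpa using hmaps hmem

end SegmentProperty

variable {n : ℕ} {Ω : Set (Space n)}

theorem orthogonalProjectionOnto_add_smul_self {F : Type*} [NormedAddCommGroup F]
    [InnerProductSpace ℝ F] (ν y : F) (t : ℝ) :
    (ℝ ∙ ν)ᗮ.orthogonalProjectionOnto (y + t • ν) = (ℝ ∙ ν)ᗮ.orthogonalProjectionOnto y := by
  rw [map_add, map_smul, Submodule.orthogonalProjectionOnto_orthogonal_apply_eq_zero
    (Submodule.mem_span_singleton_self ν), smul_zero, add_zero]

theorem IsLipschitzDomain.hasSegmentProperty (hΩ : IsLipschitzDomain Ω) :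
    HasSegmentProperty Ω := by
  intro x hx
  obtain ⟨ν, r, L, γ, hν, hr, hγ, hchart⟩ := hΩ.lipschitz_boundary x hx
  refine ⟨ball x (r / 2), ball_mem_nhds x (half_pos hr), ν, ?_⟩
  filter_upwards [Ioo_mem_nhdsGT (half_pos hr)] with t ht y hy
  have hy_ball : y ∈ ball x r := ball_subset_ball (half_le_self hr.le) hy.2
  have hγy : γ ((ℝ ∙ ν)ᗮ.orthogonalProjectionOnto y) ≤ inner ℝ ν y :=
    le_on_closure (s := ball x r ∩ Ω) (fun z hz ↦ ((hchart z hz.1).1 hz.2).le)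
      (hγ.continuous.comp (by fun_prop)).continuousOn (by fun_prop)
      (isOpen_ball.inter_closure ⟨hy_ball, hy.1⟩)
  have hyt_ball : y + t • ν ∈ ball x r := by
    have hdist : dist (y + t • ν) y = t := by
      rw [dist_eq_norm, add_sub_cancel_left, norm_smul, hν, mul_one, Real.norm_of_nonneg ht.1.le]
    rw [mem_ball]
    linarith [dist_triangle (y + t • ν) y x, mem_ball.1 hy.2, ht.2]
  rw [hchart _ hyt_ball, orthogonalProjectionOnto_add_smul_self, inner_add_right,
    inner_smul_right, real_inner_self_eq_norm_sq, hν]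
  linarith [ht.1]

theorem addHaar_convexHull_eq_zero_of_card_le {E : Type*} [NormedAddCommGroup E]
    [NormedSpace ℝ E] [FiniteDimensional ℝ E] [MeasurableSpace E] [BorelSpace E] (μ : Measure E)
    [μ.IsAddHaarMeasure] {s : Finset E} (hs : s.card ≤ Module.finrank ℝ E) :
    μ (convexHull ℝ (s : Set E)) = 0 := by
  refine measure_mono_null (convexHull_subset_affineSpan _)
    (Measure.addHaar_affineSubspace μ _ fun htop ↦ ?_)
  have hne : (s : Set E).Nonempty :=
    (affineSpan_nonempty ℝ).1 (by simp [htop])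
  have : Nonempty s := hne.to_subtype
  have hdim := finrank_vectorSpan_range_add_one_le ℝ (fun i : s ↦ (i : E))
  rw [Subtype.range_coe_subtype, ← direction_affineSpan, Finset.setOfPred_mem, htop,
    AffineSubspace.direction_top, finrank_top, Fintype.card_coe] at hdim
  omega

variable {T : Triangulation Ω} {s t : Finset (Space n)}

theorem Triangulation.mem_cells : s ∈ T.cells ↔ s ∈ T.faces ∧ s.card = n + 1 := by
  simp [Triangulation.cells]

theorem isOpen_cellInterior (s : Finset (Space n)) : IsOpen (cellInterior s) := isOpen_interior

theorem Triangulation.cellInterior_subset_interior_closure (hs : s ∈ T.cells) :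
    cellInterior s ⊆ interior (closure Ω) := by
  rw [← T.space_eq]
  exact interior_mono (Geometry.SimplicialComplex.convexHull_subset_space (mem_cells.1 hs).1)

variable (T)

theorem Triangulation.pairwiseDisjoint_cellInterior :
    (T.cells : Set (Finset (Space n))).PairwiseDisjoint cellInterior := by
  classical
  intro s hs t ht hst
  obtain ⟨hs, hs_card⟩ := mem_cells.1 (Finset.mem_coe.1 hs)
  obtain ⟨ht, ht_card⟩ := mem_cells.1 (Finset.mem_coe.1 ht)
  have hcard : (s ∩ t).card ≤ n := by
    by_contra! hlt
    have hs_eq : s ∩ t = s := Finset.eq_of_subset_of_card_le Finset.inter_subset_left (by omega)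
    have ht_eq : s ∩ t = t := Finset.eq_of_subset_of_card_le Finset.inter_subset_right (by omega)
    exact hst (hs_eq.symm.trans ht_eq)
  have hnull : volume (cellInterior s ∩ cellInterior t) = 0 := by
    refine measure_mono_null (inter_subset_inter interior_subset interior_subset)
      (measure_mono_null (T.inter_subset_convexHull hs ht) ?_)
    rw [← Finset.coe_inter]
    exact addHaar_convexHull_eq_zero_of_card_le volume (by simpa using hcard)
  exact disjoint_iff_inter_eq_empty.2
    (((isOpen_cellInterior s).inter (isOpen_cellInterior t)).eq_empty_of_measure_zero hnull)

variable {T} in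
theorem Triangulation.card_le_of_mem_faces (hs : s ∈ T.faces) : s.card ≤ n + 1 := by
  have hle := (T.indep hs).card_le_finrank_succ
  rw [Fintype.card_coe] at hle
  refine hle.trans (Nat.add_le_add_right ((Submodule.finrank_le _).trans ?_) 1)
  rw [finrank_euclideanSpace_fin]

theorem Triangulation.volume_diff_biUnion_cellInterior :
    volume (closure Ω \ ⋃ s ∈ T.cells, cellInterior s) = 0 := by
  have hsub : closure Ω \ (⋃ s ∈ T.cells, cellInterior s) ⊆
      (⋃ s ∈ T.finite_faces.toFinset.filter (fun s ↦ s.card ≤ n), convexHull ℝ (s : Set (Space n)))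
      ∪ ⋃ s ∈ T.cells, frontier (convexHull ℝ (s : Set (Space n))) := by
    rintro x ⟨hx, hx_cells⟩
    rw [← T.space_eq] at hx
    obtain ⟨s, hs, hxs⟩ := Geometry.SimplicialComplex.mem_space_iff.1 hx
    rcases (card_le_of_mem_faces hs).eq_or_lt with hcard | hcard
    · have hs_cell : s ∈ T.cells := mem_cells.2 ⟨hs, hcard⟩
      exact Or.inr (mem_iUnion₂.2 ⟨s, hs_cell, subset_closure hxs,
        fun hx_int ↦ hx_cells (mem_iUnion₂.2 ⟨s, hs_cell, hx_int⟩)⟩)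
    · exact Or.inl (mem_iUnion₂.2 ⟨s, by simp [hs, Nat.lt_succ_iff.1 hcard], hxs⟩)
  refine measure_mono_null hsub (measure_union_null ?_ ?_)
  · exact (measure_biUnion_null_iff (Finset.countable_toSet _)).2 fun s hs ↦
      addHaar_convexHull_eq_zero_of_card_le volume (by simpa using (Finset.mem_filter.1 hs).2)
  · exact (measure_biUnion_null_iff (Finset.countable_toSet _)).2 fun s _ ↦
      (convex_convexHull ℝ _).addHaar_frontier volume

theorem Triangulation.biUnion_cellInterior_ae_eq (hΩ : interior (closure Ω) = Ω) :
    (⋃ s ∈ T.cells, cellInterior s : Set (Space n)) =ᵐ[volume] Ω := by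
  have hsub : (⋃ s ∈ T.cells, cellInterior s) ⊆ Ω :=
    iUnion₂_subset fun s hs ↦ (cellInterior_subset_interior_closure hs).trans hΩ.subset
  refine hsub.eventuallyLE.antisymm (ae_le_set.2 ?_)
  exact measure_mono_null (sdiff_subset_sdiff_left subset_closure)
    T.volume_diff_biUnion_cellInterior

end Geometry

section ExteriorAlgebra

open Equiv Sum

section SignedSum

variable {ι : Type*} [Fintype ι] [DecidableEq ι]

/-- The signed sum over all permutations, by which the exterior product is computed. -/
def signedSum (F : Perm ι → ℝ) : ℝ := ∑ π : Perm ι, (Perm.sign π : ℝ) * F π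

theorem sign_mul_self (τ : Perm ι) : ((Perm.sign τ : ℤˣ) : ℝ) * (Perm.sign τ : ℤˣ) = 1 := by
  rw [← Int.cast_mul, ← Units.val_mul, Int.units_mul_self, Units.val_one, Int.cast_one]

theorem signedSum_comp_mul_right (τ : Perm ι) (F : Perm ι → ℝ) :
    signedSum (fun π ↦ F (π * τ)) = Perm.sign τ * signedSum F := by
  rw [signedSum, signedSum, Finset.mul_sum,
    ← Equiv.sum_comp (Equiv.mulRight τ) fun π ↦ _ * (_ * F π)]
  refine Finset.sum_congr rfl fun π _ ↦ ?_
  rw [Equiv.coe_mulRight, Perm.sign_mul, Units.val_mul, Int.cast_mul]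
  linear_combination -(Perm.sign π : ℝ) * F (π * τ) * sign_mul_self τ

theorem signedSum_finsetSum {β : Type*} (s : Finset β) (F : β → Perm ι → ℝ) :
    signedSum (fun π ↦ ∑ i ∈ s, F i π) = ∑ i ∈ s, signedSum (F i) := by
  simp only [signedSum, Finset.mul_sum]
  exact Finset.sum_comm

theorem signedSum_const_mul (c : ℝ) (F : Perm ι → ℝ) :
    signedSum (fun π ↦ c * F π) = c * signedSum F := by
  simp only [signedSum, Finset.mul_sum, mul_left_comm]

theorem abs_signedSum_le {F : Perm ι → ℝ} {C : ℝ} (hF : ∀ π, |F π| ≤ C) :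
    |signedSum F| ≤ (Fintype.card ι).factorial * C := by
  have hterm : ∀ π : Perm ι, |(Perm.sign π : ℝ) * F π| ≤ C := fun π ↦ by
    rw [abs_mul, ← Int.cast_abs, Int.isUnit_iff_abs_eq.1 (Units.isUnit _), Int.cast_one, one_mul]
    exact hF π
  refine (Finset.abs_sum_le_sum_abs _ _).trans ((Finset.sum_le_sum fun π _ ↦ hterm π).trans ?_)
  rw [Finset.sum_const, Finset.card_univ, Fintype.card_perm, nsmul_eq_mul]

end SignedSum

variable {n k l m : ℕ} {𝔤 : Type*} [NormedAddCommGroup 𝔤] [InnerProductSpace ℝ 𝔤]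

/-- The standard basis vectors of `ℝⁿ`. -/
noncomputable abbrev stdVec (i : Fin n) : Space n := EuclideanSpace.basisFun (Fin n) ℝ i

/-- The splitting of `Fin n` into its first `k` and its last `l` elements. -/
def splitFin (h : k + l = n) : Fin k ⊕ Fin l ≃ Fin n := finSumFinEquiv.trans (finCongr h)

@[simp] theorem splitFin_inl_val (h : k + l = n) (i : Fin k) :
    (splitFin h (inl i) : ℕ) = i := by simp [splitFin]

@[simp] theorem splitFin_inr_val (h : k + l = n) (i : Fin l) :
    (splitFin h (inr i) : ℕ) = k + i := by simp [splitFin]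

theorem factorial_mul_wedgeCoeff (h : k + l = n) (u : Covector n k 𝔤) (v : Covector n l 𝔤) :
    ((k.factorial * l.factorial : ℕ) : ℝ) * wedgeCoeff h u v =
      signedSum fun π ↦ inner ℝ (u fun i ↦ stdVec (π (splitFin h (inl i))))
        (v fun j ↦ stdVec (π (splitFin h (inr j)))) := by
  have hdomCoprod := congrArg (fun F ↦ TensorProduct.lift (innerₗ 𝔤) (F fun i ↦
    stdVec (splitFin h i)))
    (MultilinearMap.domCoprod_alternization_eq u.toAlternatingMap v.toAlternatingMap)
  simp only [Fintype.card_fin, AlternatingMap.smul_apply, map_nsmul, nsmul_eq_mul] at hdomCoprod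
  have hcoeff : wedgeCoeff h u v = TensorProduct.lift (innerₗ 𝔤)
    ((u.toAlternatingMap.domCoprod v.toAlternatingMap) fun i ↦ stdVec (splitFin h i)) := rfl
  rw [hcoeff, ← hdomCoprod, MultilinearMap.alternatization_apply, map_sum, signedSum,
    ← (splitFin h).permCongr.sum_comp]
  refine Finset.sum_congr rfl fun σ _ ↦ ?_
  rw [Perm.sign_permCongr, Units.smul_def, map_zsmul, zsmul_eq_mul]
  simp [MultilinearMap.domDomCongr_apply]

variable (𝔤) in
/-- The coefficient of the exterior product as a bilinear form. -/
noncomputable def wedgeBilin (h : k + l = n) : Covector n k 𝔤 →ₗ[ℝ] Covector n l 𝔤 →ₗ[ℝ] ℝ :=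
  LinearMap.mk₂ ℝ (wedgeCoeff h)
    (fun u u' v ↦ by
      simp [wedgeCoeff, wedgeInner, ← AlternatingMap.domCoprod'_apply, TensorProduct.add_tmul])
    (fun c u v ↦ by
      simp [wedgeCoeff, wedgeInner, ← AlternatingMap.domCoprod'_apply, ← TensorProduct.smul_tmul'])
    (fun u v v' ↦ by
      simp [wedgeCoeff, wedgeInner, ← AlternatingMap.domCoprod'_apply, TensorProduct.tmul_add])
    (fun c u v ↦ by
      simp [wedgeCoeff, wedgeInner, ← AlternatingMap.domCoprod'_apply])

theorem norm_covector_stdVec_le (u : Covector n k 𝔤) (a : Fin k → Fin n) :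
    ‖u fun i ↦ stdVec (a i)‖ ≤ ‖u‖ := by
  simpa using u.le_opNorm fun i ↦ stdVec (a i)

theorem abs_wedgeCoeff_le (h : k + l = n) (u : Covector n k 𝔤) (v : Covector n l 𝔤) :
    |wedgeCoeff h u v| ≤ n.factorial * ‖u‖ * ‖v‖ := by
  have hsum : ((k.factorial * l.factorial : ℕ) : ℝ) * |wedgeCoeff h u v| ≤
      n.factorial * (‖u‖ * ‖v‖) := by
    rw [← Nat.abs_cast, ← abs_mul, factorial_mul_wedgeCoeff]
    refine (abs_signedSum_le fun π ↦ (abs_real_inner_le_norm _ _).trans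
      (mul_le_mul (norm_covector_stdVec_le u _) (norm_covector_stdVec_le v _) (norm_nonneg _)
        (norm_nonneg _))).trans_eq ?_
    rw [Fintype.card_fin]
  rw [mul_assoc]
  refine (le_mul_of_one_le_left (abs_nonneg _) ?_).trans hsum
  exact_mod_cast Nat.one_le_iff_ne_zero.2
    (mul_ne_zero k.factorial_ne_zero l.factorial_ne_zero)

variable (𝔤) in
/-- The coefficient of the exterior product as a continuous bilinear form. -/
noncomputable def wedgeCLM (h : k + l = n) : Covector n k 𝔤 →L[ℝ] Covector n l 𝔤 →L[ℝ] ℝ :=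
  (wedgeBilin 𝔤 h).mkContinuous₂ n.factorial (abs_wedgeCoeff_le h)

theorem coe_finRotate_pow (n l : ℕ) (x : Fin n) : ((finRotate n ^ l) x : ℕ) = (x + l) % n := by
  obtain _ | n := n
  · exact x.elim0
  induction l with
  | zero => simp [Nat.mod_eq_of_lt x.2]
  | succ l ih => rw [pow_succ', Perm.mul_apply, finRotate_apply, Fin.val_add, ih, Fin.val_one',
      ← Nat.add_mod, add_assoc]

theorem sign_finRotate_pow (h : k + l = n) :
    ((Perm.sign (finRotate n ^ l) : ℤˣ) : ℝ) = (-1) ^ (k * l) := by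
  obtain _ | l := l
  · simp
  obtain rfl : n = k + l + 1 := by omega
  rw [map_pow, sign_finRotate, ← pow_mul, Nat.add_sub_cancel, add_mul, pow_add,
    (Nat.even_mul_succ_self l).neg_one_pow]
  simp

theorem wedgeCoeff_comm (h : k + l = n) (h' : l + k = n) (u : Covector n k 𝔤)
    (v : Covector n l 𝔤) : wedgeCoeff h u v = (-1) ^ (k * l) * wedgeCoeff h' v u := by
  have hpos : ((k.factorial * l.factorial : ℕ) : ℝ) ≠ 0 := by positivity
  apply mul_left_cancel₀ hpos
  have hleft (i : Fin k) : (finRotate n ^ l) (splitFin h (inl i)) = splitFin h' (inr i) := by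
    ext
    rw [coe_finRotate_pow, splitFin_inl_val, splitFin_inr_val, Nat.mod_eq_of_lt (by omega),
      add_comm]
  have hright (j : Fin l) : (finRotate n ^ l) (splitFin h (inr j)) = splitFin h' (inl j) := by
    ext
    rw [coe_finRotate_pow, splitFin_inl_val, splitFin_inr_val,
      show k + (j : ℕ) + l = j + n by omega, Nat.add_mod_right, Nat.mod_eq_of_lt (by omega)]
  have hrotate := signedSum_comp_mul_right (finRotate n ^ l) fun π ↦ inner ℝ
    (u fun i ↦ stdVec (π (splitFin h (inl i)))) (v fun j ↦ stdVec (π (splitFin h (inr j))))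
  simp only [Perm.mul_apply, hleft, hright] at hrotate
  rw [mul_left_comm, factorial_mul_wedgeCoeff, mul_comm k.factorial, factorial_mul_wedgeCoeff,
    ← sign_finRotate_pow h]
  simp_rw [real_inner_comm (u _) (v _)] at hrotate ⊢
  rw [hrotate, ← mul_assoc, sign_mul_self, one_mul]

/-- The exterior product `ℓ ∧ u` of a real-valued linear form with a covector. -/
noncomputable def covWedge (ℓ : Space n →L[ℝ] ℝ) (u : Covector n k 𝔤) : Covector n (k + 1) 𝔤 :=
  ContinuousAlternatingMap.alternatizeUncurryFin (ℓ.smulRight u)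

theorem covWedge_apply (ℓ : Space n →L[ℝ] ℝ) (u : Covector n k 𝔤) (v : Fin (k + 1) → Space n) :
    covWedge ℓ u v = ∑ i : Fin (k + 1), ((-1) ^ (i : ℕ) * ℓ (v i)) • u (i.removeNth v) := by
  simp [covWedge, ContinuousAlternatingMap.alternatizeUncurryFin_apply, mul_smul,
    ← Int.cast_smul_eq_zsmul ℝ]

theorem signedSum_comp_cycleRange (e : Fin (k + 1) ⊕ Fin m ≃ Fin n)
    (Φ : (Fin (k + 1) → Fin n) → (Fin m → Fin n) → ℝ) (i : Fin (k + 1)) :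
    signedSum (fun π ↦ Φ (fun j ↦ π (e (inl (i.cycleRange.symm j)))) fun j ↦ π (e (inr j))) =
      (-1) ^ (i : ℕ) * signedSum fun π ↦ Φ (fun j ↦ π (e (inl j))) fun j ↦ π (e (inr j)) := by
  have hcycle := signedSum_comp_mul_right (e.permCongr (Perm.sumCongr i.cycleRange.symm 1))
    fun π ↦ Φ (fun j ↦ π (e (inl j))) fun j ↦ π (e (inr j))
  simpa [Equiv.permCongr_apply, Perm.sign_permCongr, Perm.sign_sumCongr] using hcycle

theorem signedSum_inner_covWedge (e : Fin (k + 1) ⊕ Fin m ≃ Fin n) (ℓ : Space n →L[ℝ] ℝ)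
    (u : Covector n k 𝔤) (v : Covector n m 𝔤) :
    signedSum (fun π ↦ inner ℝ (covWedge ℓ u fun i ↦ stdVec (π (e (inl i))))
        (v fun j ↦ stdVec (π (e (inr j))))) =
      (k + 1) * signedSum fun π ↦ ℓ (stdVec (π (e (inl 0)))) *
        inner ℝ (u fun i ↦ stdVec (π (e (inl i.succ)))) (v fun j ↦ stdVec (π (e (inr j)))) := by
  simp_rw [covWedge_apply, sum_inner, real_inner_smul_left, mul_assoc]
  rw [signedSum_finsetSum]
  have hterm (i : Fin (k + 1)) : signedSum (fun π ↦ (-1) ^ (i : ℕ) *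
      (ℓ (stdVec (π (e (inl i)))) * inner ℝ (u (i.removeNth fun j ↦ stdVec (π (e (inl j)))))
        (v fun j ↦ stdVec (π (e (inr j)))))) =
      signedSum fun π ↦ ℓ (stdVec (π (e (inl 0)))) *
        inner ℝ (u fun i ↦ stdVec (π (e (inl i.succ)))) (v fun j ↦ stdVec (π (e (inr j)))) := by
    have hcycle := signedSum_comp_cycleRange e (fun a b ↦ ℓ (stdVec (a 0)) *
      inner ℝ (u fun j ↦ stdVec (a j.succ)) (v fun j ↦ stdVec (b j))) i
    simp only [Fin.cycleRange_symm_zero, Fin.cycleRange_symm_succ] at hcycle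
    rw [signedSum_const_mul]
    refine (congrArg _ hcycle).trans ?_
    rw [← mul_assoc, ← mul_pow, neg_one_mul, neg_neg, one_pow, one_mul]
  rw [Finset.sum_congr rfl fun i _ ↦ hterm i]
  simp

theorem factorial_mul_wedgeCoeff_covWedge_left (h : k + 1 + m = n) (ℓ : Space n →L[ℝ] ℝ)
    (u : Covector n k 𝔤) (v : Covector n m 𝔤) :
    ((k.factorial * m.factorial : ℕ) : ℝ) * wedgeCoeff h (covWedge ℓ u) v =
      signedSum fun π ↦ ℓ (stdVec (π (splitFin h (inl 0)))) *
        inner ℝ (u fun i ↦ stdVec (π (splitFin h (inl i.succ))))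
          (v fun j ↦ stdVec (π (splitFin h (inr j)))) := by
  apply mul_left_cancel₀ (Nat.cast_add_one_ne_zero (R := ℝ) k)
  rw [← signedSum_inner_covWedge, ← factorial_mul_wedgeCoeff, Nat.factorial_succ]
  push_cast
  ring

theorem factorial_mul_wedgeCoeff_covWedge_right (h : k + (m + 1) = n) (ℓ : Space n →L[ℝ] ℝ)
    (u : Covector n k 𝔤) (v : Covector n m 𝔤) :
    ((k.factorial * m.factorial : ℕ) : ℝ) * wedgeCoeff h u (covWedge ℓ v) =
      signedSum fun π ↦ ℓ (stdVec (π (splitFin h (inr 0)))) *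
        inner ℝ (u fun i ↦ stdVec (π (splitFin h (inl i))))
          (v fun j ↦ stdVec (π (splitFin h (inr j.succ)))) := by
  apply mul_left_cancel₀ (Nat.cast_add_one_ne_zero (R := ℝ) m)
  have hexpand := signedSum_inner_covWedge ((Equiv.sumComm _ _).trans (splitFin h)) ℓ v u
  simp only [Equiv.trans_apply, Equiv.sumComm_apply, Sum.swap_inl, Sum.swap_inr] at hexpand
  simp_rw [real_inner_comm (u _)] at hexpand
  rw [← hexpand, ← factorial_mul_wedgeCoeff, Nat.factorial_succ]
  push_cast
  ring

theorem wedgeCoeff_covWedge_left (h : k + 1 + m = n) (h' : k + (m + 1) = n) (ℓ : Space n →L[ℝ] ℝ)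
    (u : Covector n k 𝔤) (v : Covector n m 𝔤) :
    wedgeCoeff h (covWedge ℓ u) v = (-1) ^ k * wedgeCoeff h' u (covWedge ℓ v) := by
  have hpos : ((k.factorial * m.factorial : ℕ) : ℝ) ≠ 0 := by positivity
  apply mul_left_cancel₀ hpos
  rw [mul_left_comm, factorial_mul_wedgeCoeff_covWedge_left,
    factorial_mul_wedgeCoeff_covWedge_right]
  set c : Fin n := ⟨k, by omega⟩
  have hform : c.cycleRange (splitFin h' (inr 0)) = splitFin h (inl 0) := by
    have hc : splitFin h' (inr 0) = c := by ext; simp [c]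
    ext
    simp [hc, Fin.coe_cycleRange_of_le le_rfl]
  have hleft (i : Fin k) : c.cycleRange (splitFin h' (inl i)) = splitFin h (inl i.succ) := by
    ext
    rw [Fin.coe_cycleRange_of_lt (by simp [Fin.lt_def, c])]
    simp
  have hright (j : Fin m) : c.cycleRange (splitFin h' (inr j.succ)) = splitFin h (inr j) := by
    rw [Fin.cycleRange_of_gt (by simp [Fin.lt_def, c])]
    ext
    simp [add_assoc, add_comm 1]
  have hcycle := signedSum_comp_mul_right c.cycleRange fun π ↦
    ℓ (stdVec (π (splitFin h' (inr 0)))) *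
      inner ℝ (u fun i ↦ stdVec (π (splitFin h' (inl i))))
        (v fun j ↦ stdVec (π (splitFin h' (inr j.succ))))
  simpa only [Perm.mul_apply, hform, hleft, hright, Fin.sign_cycleRange, Units.val_pow_eq_pow_val,
    Units.val_neg, Units.val_one, Int.cast_pow, Int.cast_neg, Int.cast_one] using hcycle

theorem map_stdVec_perm (u : Covector n n 𝔤) (π : Perm (Fin n)) :
    (u fun i ↦ stdVec (π i)) = (Perm.sign π : ℝ) • u fun i ↦ stdVec i := by
  rw [Int.cast_smul_eq_zsmul]
  exact u.toAlternatingMap.map_perm (fun i ↦ stdVec i) π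

theorem wedgeCoeff_zero_right (u : Covector n n 𝔤) (v : Covector n 0 𝔤) :
    wedgeCoeff (add_zero n) u v = inner ℝ (u fun i ↦ stdVec i) (v 0) := by
  have hpos : ((n.factorial * Nat.factorial 0 : ℕ) : ℝ) ≠ 0 := by positivity
  apply mul_left_cancel₀ hpos
  have hterm (π : Perm (Fin n)) :
      inner ℝ (u fun i ↦ stdVec (π (splitFin (add_zero n) (inl i))))
        (v fun j ↦ stdVec (π (splitFin (add_zero n) (inr j)))) =
      Perm.sign π * inner ℝ (u fun i ↦ stdVec i) (v 0) := by
    rw [Subsingleton.elim (fun j ↦ stdVec (π (splitFin (add_zero n) (inr j)))) 0,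
      ← real_inner_smul_left, ← map_stdVec_perm]
    rfl
  rw [factorial_mul_wedgeCoeff, signedSum, Finset.sum_congr rfl fun π _ ↦ by rw [hterm π]]
  simp [← mul_assoc, sign_mul_self, Fintype.card_perm]

theorem covector_ext {u : Covector n k 𝔤}
    (hu : ∀ a : Fin k → Fin n, Function.Injective a → (u fun i ↦ stdVec (a i)) = 0) : u = 0 := by
  apply ContinuousAlternatingMap.toAlternatingMap_injective
  refine Module.Basis.ext_alternating (EuclideanSpace.basisFun (Fin n) ℝ).toBasis fun a ha ↦ ?_
  simpa using hu a ha

theorem covector_eq_zero_of_lt (hk : n < k) (u : Covector n k 𝔤) : u = 0 :=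
  covector_ext fun a ha ↦ absurd (Fintype.card_le_of_injective a ha) (by simpa using hk)

theorem eq_zero_of_covWedge_eq_zero (hk : k < n) {u : Covector n k 𝔤}
    (hu : ∀ ℓ : Space n →L[ℝ] ℝ, covWedge ℓ u = 0) : u = 0 := by
  refine covector_ext fun a _ ↦ ?_
  obtain ⟨i, hi⟩ : ∃ i : Fin n, ∀ j, i ≠ a j := by
    by_contra! hsurj
    have hcard := Fintype.card_le_of_surjective a fun i ↦ (hsurj i).imp fun _ ↦ Eq.symm
    rw [Fintype.card_fin, Fintype.card_fin] at hcard
    omega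
  have hcons := congrArg (fun w ↦ w (Fin.cons (stdVec i) fun j ↦ stdVec (a j)))
    (hu (EuclideanSpace.proj i))
  simpa [covWedge_apply, Fin.sum_univ_succ, hi] using hcons

theorem eq_zero_of_wedgeCoeff_eq_zero (h : k + l = n) (u : Covector n k 𝔤)
    (hu : ∀ v : Covector n l 𝔤, wedgeCoeff h u v = 0) : u = 0 := by
  induction l generalizing k with
  | zero =>
    subst h
    have htop := hu (ContinuousAlternatingMap.constOfIsEmpty ℝ (Space k) (Fin 0)
      (u fun i ↦ stdVec i))
    rw [wedgeCoeff_zero_right] at htop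
    refine covector_ext fun a ha ↦ ?_
    have hperm := map_stdVec_perm u (Equiv.ofBijective a (Finite.injective_iff_bijective.1 ha))
    rwa [inner_self_eq_zero.1 htop, smul_zero] at hperm
  | succ l ih =>
    refine eq_zero_of_covWedge_eq_zero (by omega) fun ℓ ↦ ih (by omega) _ fun v ↦ ?_
    rw [wedgeCoeff_covWedge_left _ h, hu, mul_zero]

end ExteriorAlgebra

section Pairing

open Set Filter Topology ContinuousLinearMap
open scoped Convolution

variable {E F G : Type*} [NormedAddCommGroup E] [NormedSpace ℝ E] [FiniteDimensional ℝ E]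
  [MeasurableSpace E] [BorelSpace E] {μ : Measure E}
  [NormedAddCommGroup F] [NormedSpace ℝ F] [NormedAddCommGroup G] [NormedSpace ℝ G]
  {p q : ENNReal} {f : E → F} {g : E → G}

theorem integrable_bilin_of_memLp {α : Type*} [MeasurableSpace α] {ν : Measure α}
    [p.HolderConjugate q] (P : F →L[ℝ] G →L[ℝ] ℝ) {f : α → F} {g : α → G} (hf : MemLp f p ν)
    (hg : MemLp g q ν) : Integrable (fun x ↦ P (f x) (g x)) ν :=
  memLp_one_iff_integrable.1 (P.memLp_of_bilin 1 hf hg)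

theorem integrable_bilin_of_locallyIntegrableOn {H : Type*} [NormedAddCommGroup H]
    [NormedSpace ℝ H] (P : F →L[ℝ] G →L[ℝ] H) {U : Set E} (hf : LocallyIntegrableOn f U μ)
    (hg : Continuous g) (hgc : HasCompactSupport g) (hgU : tsupport g ⊆ U) :
    Integrable (fun x ↦ P (f x) (g x)) μ := by
  have hsupport : Function.support (fun x ↦ P (f x) (g x)) ⊆ tsupport g := fun x hx ↦ by
    by_contra hxg
    exact hx (by simp [image_eq_zero_of_notMem_tsupport hxg])
  obtain ⟨C, hC⟩ := hgc.exists_bound_of_continuous hg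
  exact (integrableOn_iff_integrable_of_support_subset hsupport).1
    (P.integrable_of_bilin_of_bdd_right C (hf.integrableOn_compact_subset hgU hgc)
      hg.aestronglyMeasurable (.of_forall hC))

variable [μ.IsAddHaarMeasure]

theorem continuous_integral_bilin_translate_of_ne_top [p.HolderConjugate q] (hq : q ≠ ⊤)
    (P : F →L[ℝ] G →L[ℝ] ℝ) (hf : MemLp f p μ) (hg : MemLp g q μ) :
    Continuous fun z ↦ ∫ x, P (f x) (g (x + z)) ∂μ := by
  have : Fact (1 ≤ p) := ⟨ENNReal.HolderConjugate.one_le p q⟩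
  have : Fact (1 ≤ q) := ⟨ENNReal.HolderConjugate.one_le q p⟩
  have hshift (z : E) : MeasurePreserving (· + z) μ μ := measurePreserving_add_right μ z
  have hcont : Continuous fun z : E ↦ (⟨(· + z), by fun_prop⟩ : C(E, E)) :=
    ContinuousMap.continuous_of_continuous_uncurry _ (continuous_snd.add continuous_fst)
  refine ((P.lpPairing μ p q (hf.toLp f)).continuous.comp
    ((continuous_const (y := hg.toLp g)).compMeasurePreservingLp hcont hshift hq)).congr
    fun z ↦ ?_
  rw [Function.comp_apply, lpPairing_eq_integral]
  refine integral_congr_ae ?_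
  filter_upwards [hf.coeFn_toLp, Lp.coeFn_compMeasurePreserving (hg.toLp g) (hshift z),
    (hshift z).quasiMeasurePreserving.ae_eq_comp hg.coeFn_toLp] with x hfx hgx hgx'
  rw [hfx]
  exact congrArg (P (f x)) (hgx.trans hgx')

theorem continuous_integral_bilin_translate [p.HolderConjugate q] (P : F →L[ℝ] G →L[ℝ] ℝ)
    (hf : MemLp f p μ) (hg : MemLp g q μ) : Continuous fun z ↦ ∫ x, P (f x) (g (x + z)) ∂μ := by
  by_cases hq : q = ⊤
  · subst hq
    have hp : p ≠ ⊤ := ENNReal.HolderConjugate.unique ⊤ p 1 ▸ ENNReal.one_ne_top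
    refine ((continuous_integral_bilin_translate_of_ne_top hp P.flip hg hf).comp
      continuous_neg).congr fun z ↦ ?_
    rw [Function.comp_apply, ← integral_add_right_eq_self _ z]
    simp only [flip_apply, add_neg_cancel_right]
  · exact continuous_integral_bilin_translate_of_ne_top hq P hf hg

theorem integral_bilin_convolution [p.HolderConjugate q] [CompleteSpace F]
    (P : F →L[ℝ] G →L[ℝ] ℝ) (hf : MemLp f p μ) (hg : MemLp g q μ) {ρ : E → ℝ}
    (hρ : Continuous ρ) (hρc : HasCompactSupport ρ) :
    ∫ x, P ((ρ ⋆[lsmul ℝ ℝ, μ] f) x) (g x) ∂μ = ∫ z, ρ z * ∫ x, P (f x) (g (x + z)) ∂μ ∂μ := by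
  let g' : E → G := fun x ↦ g (-x)
  have hg' : AEStronglyMeasurable g' μ :=
    hg.1.comp_quasiMeasurePreserving (Measure.measurePreserving_neg μ).quasiMeasurePreserving
  have hfg' (z : E) : ConvolutionExistsAt (fun x ↦ ‖f x‖) (fun x ↦ ‖g' x‖) z (mul ℝ ℝ) μ := by
    have := hg.norm.comp_measurePreserving (measurePreserving_sub_right μ z)
    refine (integrable_bilin_of_memLp (mul ℝ ℝ) hf.norm this).congr (.of_forall fun x ↦ ?_)
    simp [g']
  have hnorm : (fun x ↦ ‖f x‖) ⋆[mul ℝ ℝ, μ] (fun x ↦ ‖g' x‖) =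
      fun z ↦ ∫ x, mul ℝ ℝ ‖f x‖ ‖g (x + -z)‖ ∂μ := by
    ext z
    simp [convolution_def, g', sub_eq_add_neg]
  have hcont := (continuous_integral_bilin_translate (mul ℝ ℝ) hf.norm hg.norm).comp
    continuous_neg
  have hassoc := convolution_assoc (lsmul ℝ ℝ) P (lsmul ℝ ℝ) P (fun r x y ↦ by simp)
    (x₀ := 0) hρ.aestronglyMeasurable hf.1 hg'
    (.of_forall (hρc.convolutionExists_left _ hρ
      (hf.locallyIntegrable (ENNReal.HolderConjugate.one_le p q)))) (.of_forall hfg')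
    (hρc.norm.convolutionExists_left _ hρ.norm (hnorm ▸ hcont.locallyIntegrable) 0)
  simpa [convolution_def, g', add_comm] using hassoc

end Pairing

noncomputable section FirstOrder

open Set Filter Topology ContinuousLinearMap
open scoped Convolution

section

variable {E : Type*} [NormedAddCommGroup E] [NormedSpace ℝ E] [FiniteDimensional ℝ E]

theorem clm_eq_sum_smulRight {ι X : Type*} [Fintype ι] [NormedAddCommGroup X] [NormedSpace ℝ X]
    (e : Module.Basis ι ℝ E) (A : E →L[ℝ] X) :
    A = ∑ i, (LinearMap.toContinuousLinearMap (e.coord i)).smulRight (A (e i)) := by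
  ext v
  conv_lhs => rw [← e.sum_repr v, map_sum]
  simp

theorem clm_convolution_apply {F G H : Type*} [MeasurableSpace E] [BorelSpace E] {μ : Measure E}
    [μ.IsAddHaarMeasure] [NormedAddCommGroup F] [NormedSpace ℝ F] [NormedAddCommGroup G]
    [NormedSpace ℝ G] [NormedAddCommGroup H] [NormedSpace ℝ H] [CompleteSpace H] (L : H →L[ℝ] ℝ)
    (B : F →L[ℝ] G →L[ℝ] H) {f : E → F} {g : E → G} {x : E}
    (hfg : ConvolutionExistsAt f g x B μ) :
    L ((f ⋆[B, μ] g) x) = ∫ t, L (B (f (x - t)) (g t)) ∂μ := by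
  rw [convolution_eq_swap, L.integral_comp_comm hfg.integrable_swap]

end

/-- A pair of first order differential operators with constant coefficients
`u ↦ symbolLeft (Du)` and `v ↦ symbolRight (Dv)`, which are (up to sign) formally adjoint to each
other with respect to a pair of bilinear forms. -/
structure FirstOrderDuality (E X Y W Z : Type*) [NormedAddCommGroup E] [NormedSpace ℝ E]
    [NormedAddCommGroup X] [NormedSpace ℝ X] [NormedAddCommGroup Y] [NormedSpace ℝ Y]
    [NormedAddCommGroup W] [NormedSpace ℝ W] [NormedAddCommGroup Z] [NormedSpace ℝ Z] where
  /-- The symbol of the operator acting on `X`-valued functions. -/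
  symbolLeft : (E →L[ℝ] X) →L[ℝ] W
  /-- The symbol of the operator acting on `Y`-valued functions. -/
  symbolRight : (E →L[ℝ] Y) →L[ℝ] Z
  /-- The pairing of the values of the first operator with `Y`. -/
  pairLeft : W →L[ℝ] Y →L[ℝ] ℝ
  /-- The pairing of `X` with the values of the second operator. -/
  pairRight : X →L[ℝ] Z →L[ℝ] ℝ
  pair_symbol : ∀ (ℓ : E →L[ℝ] ℝ) (x : X) (y : Y),
    pairLeft (symbolLeft (ℓ.smulRight x)) y = pairRight x (symbolRight (ℓ.smulRight y))

namespace FirstOrderDuality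

variable {E X Y W Z : Type*} [NormedAddCommGroup E] [NormedSpace ℝ E]
  [NormedAddCommGroup X] [NormedSpace ℝ X] [NormedAddCommGroup Y] [NormedSpace ℝ Y]
  [NormedAddCommGroup W] [NormedSpace ℝ W] [NormedAddCommGroup Z] [NormedSpace ℝ Z]
  (S : FirstOrderDuality E X Y W Z)

/-- The same pair of operators, with the roles of the two operators exchanged. -/
def flip : FirstOrderDuality E Y X Z W where
  symbolLeft := S.symbolRight
  symbolRight := S.symbolLeft
  pairLeft := S.pairRight.flip
  pairRight := S.pairLeft.flip
  pair_symbol ℓ y x := (S.pair_symbol ℓ x y).symm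

/-- The operator acting on differentiable `X`-valued functions. -/
def opLeft (u : E → X) : E → W := fun x ↦ S.symbolLeft (fderiv ℝ u x)

/-- The operator acting on differentiable `Y`-valued functions. -/
def opRight (D : E → Y) : E → Z := fun x ↦ S.symbolRight (fderiv ℝ D x)

/-- The integrand of Green's formula: a divergence if `w` and `v` are the images of `u` and `D`. -/
def greenDensity (u : E → X) (w : E → W) (D : E → Y) (v : E → Z) : E → ℝ :=
  fun x ↦ S.pairLeft (w x) (D x) + S.pairRight (u x) (v x)

/-- The image of `χ • u` under the first operator according to the product rule, if `w` is the image
of `u`. -/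
def leibniz (χ : E → ℝ) (u : E → X) (w : E → W) : E → W :=
  fun x ↦ χ x • w x + S.symbolLeft ((fderiv ℝ χ x).smulRight (u x))

/-- `w` is the image of `u` under the first operator on `U`, in the sense of distributions. -/
def IsWeakImage [MeasurableSpace E] (μ : Measure E) (U : Set E) (u : E → X) (w : E → W) : Prop :=
  ∀ η : E → Y, ContDiff ℝ (⊤ : ℕ∞) η → HasCompactSupport η → tsupport η ⊆ U →
    ∫ x in U, S.greenDensity u w η (S.opRight η) x ∂μ = 0

/-- `w` is the image of `u` under the first operator on `U`, and the trace of `u` on the boundary of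
`U` vanishes: Green's formula without a boundary term holds for all smooth test functions. -/
def HasZeroTrace [MeasurableSpace E] (μ : Measure E) (U : Set E) (u : E → X) (w : E → W) : Prop :=
  ∀ η : E → Y, ContDiff ℝ (⊤ : ℕ∞) η → ∫ x in U, S.greenDensity u w η (S.opRight η) x ∂μ = 0

variable {u : E → X} {w : E → W} {D : E → Y} {v : E → Z}

theorem opRight_flip : S.flip.opRight = S.opLeft := rfl

theorem greenDensity_flip : S.flip.greenDensity D v u w = S.greenDensity u w D v :=
  funext fun _ ↦ add_comm _ _

theorem greenDensity_indicator_left (U : Set E) :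
    S.greenDensity (U.indicator u) (U.indicator w) D v = U.indicator (S.greenDensity u w D v) := by
  ext x
  by_cases hx : x ∈ U <;> simp [greenDensity, hx]

theorem greenDensity_indicator_right (U : Set E) :
    S.greenDensity u w (U.indicator D) (U.indicator v) = U.indicator (S.greenDensity u w D v) := by
  simp only [← S.greenDensity_flip, greenDensity_indicator_left]

variable {S} in
theorem IsWeakImage.indicator [MeasurableSpace E] {μ : Measure E} {U : Set E}
    (hU : MeasurableSet U) (h : S.IsWeakImage μ U u w) :
    S.IsWeakImage μ U (U.indicator u) (U.indicator w) := fun η hη hηc hηU ↦ by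
  rw [greenDensity_indicator_left, setIntegral_indicator hU, inter_self]
  exact h η hη hηc hηU

variable {S} in
theorem HasZeroTrace.isWeakImage_univ_indicator [MeasurableSpace E] {μ : Measure E} {U : Set E}
    (hU : MeasurableSet U) (h : S.HasZeroTrace μ U u w) :
    S.IsWeakImage μ univ (U.indicator u) (U.indicator w) := fun η hη _ _ ↦ by
  rw [greenDensity_indicator_left, setIntegral_univ, integral_indicator hU]
  exact h η hη

theorem tsupport_opLeft_subset : tsupport (S.opLeft u) ⊆ tsupport u :=
  (tsupport_comp_subset (map_zero S.symbolLeft) _).trans (tsupport_fderiv_subset ℝ)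

theorem contDiff_opLeft (hu : ContDiff ℝ (⊤ : ℕ∞) u) : ContDiff ℝ (⊤ : ℕ∞) (S.opLeft u) :=
  S.symbolLeft.contDiff.comp (hu.fderiv_right (by simp))

theorem hasCompactSupport_opLeft (hu : HasCompactSupport u) : HasCompactSupport (S.opLeft u) :=
  hu.mono' (subset_closure.trans S.tsupport_opLeft_subset)

section Support

variable [MeasurableSpace E] {μ : Measure E} {U V : Set E}

theorem setIntegral_greenDensity_left (hu : tsupport u ⊆ U) :
    ∫ x in U, S.greenDensity u (S.opLeft u) D v x ∂μ =
      ∫ x, S.greenDensity u (S.opLeft u) D v x ∂μ :=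
  setIntegral_eq_integral_of_forall_compl_eq_zero fun x hx ↦ by
    simp only [greenDensity, image_eq_zero_of_notMem_tsupport fun h ↦ hx (hu h),
      image_eq_zero_of_notMem_tsupport fun h ↦ hx (hu (S.tsupport_opLeft_subset h)), map_zero,
      _root_.zero_apply, add_zero]

theorem setIntegral_greenDensity_right (hD : tsupport D ⊆ U) :
    ∫ x in U, S.greenDensity u w D (S.opRight D) x ∂μ =
      ∫ x, S.greenDensity u w D (S.opRight D) x ∂μ := by
  have hflip := S.flip.setIntegral_greenDensity_left (μ := μ) (D := u) (v := w) hD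
  simp only [greenDensity_flip] at hflip
  exact hflip

variable {S} in
theorem IsWeakImage.mono (hVU : V ⊆ U) (h : S.IsWeakImage μ U u w) : S.IsWeakImage μ V u w :=
  fun η hη hηc hηV ↦ by
    rw [S.setIntegral_greenDensity_right hηV,
      ← S.setIntegral_greenDensity_right (hηV.trans hVU)]
    exact h η hη hηc (hηV.trans hVU)

end Support

section Smooth

variable {ι : Type*} [Fintype ι]

/-- The common coefficient of the two operators in the direction dual to the covector `ℓ`. -/
def coefficient (ℓ : E →L[ℝ] ℝ) : X →L[ℝ] Y →L[ℝ] ℝ :=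
  S.pairLeft.comp (S.symbolLeft.comp (smulRightL ℝ E X ℓ))

variable [FiniteDimensional ℝ E]

theorem pairLeft_symbolLeft (e : Module.Basis ι ℝ E) (A : E →L[ℝ] X) (y : Y) :
    S.pairLeft (S.symbolLeft A) y =
      ∑ i, S.coefficient (LinearMap.toContinuousLinearMap (e.coord i)) (A (e i)) y := by
  conv_lhs => rw [clm_eq_sum_smulRight e A, map_sum, map_sum, _root_.sum_apply]
  rfl

theorem pairRight_symbolRight (e : Module.Basis ι ℝ E) (x : X) (A : E →L[ℝ] Y) :
    S.pairRight x (S.symbolRight A) =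
      ∑ i, S.coefficient (LinearMap.toContinuousLinearMap (e.coord i)) x (A (e i)) := by
  conv_lhs => rw [clm_eq_sum_smulRight e A, map_sum, map_sum]
  exact Finset.sum_congr rfl fun i _ ↦ (S.pair_symbol _ _ _).symm

variable [MeasurableSpace E] [BorelSpace E] {μ : Measure E} [μ.IsAddHaarMeasure]

theorem isWeakImage_opLeft {U : Set E} (hu : ContDiff ℝ (⊤ : ℕ∞) u) :
    S.IsWeakImage μ U u (S.opLeft u) := fun η hη hηc hηU ↦ by
  rw [S.setIntegral_greenDensity_right hηU]
  let e := Module.finBasis ℝ E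
  let Q i := S.coefficient (LinearMap.toContinuousLinearMap (e.coord i))
  have integrable_pair (i) {f : E → X} {g : E → Y} (hf : Continuous f) (hg : Continuous g)
      (hgc : HasCompactSupport g) : Integrable (fun x ↦ Q i (f x) (g x)) μ :=
    integrable_bilin_of_locallyIntegrableOn (Q i) (hf.locallyIntegrable.locallyIntegrableOn univ)
      hg hgc (subset_univ _)
  have hud (i) := integrable_pair i ((hu.continuous_fderiv (by simp)).clm_apply
    (continuous_const (y := e i))) hη.continuous hηc
  have hηd (i) := integrable_pair i hu.continuous ((hη.continuous_fderiv (by simp)).clm_apply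
    (continuous_const (y := e i))) (hηc.fderiv_apply ℝ (e i))
  have hdensity (x : E) : S.greenDensity u (S.opLeft u) η (S.opRight η) x =
      ∑ i, (Q i (fderiv ℝ u x (e i)) (η x) + Q i (u x) (fderiv ℝ η x (e i))) := by
    rw [Finset.sum_add_distrib, ← S.pairLeft_symbolLeft e, ← S.pairRight_symbolRight e]
    rfl
  have hsum (i) : Integrable
      (fun x ↦ Q i (fderiv ℝ u x (e i)) (η x) + Q i (u x) (fderiv ℝ η x (e i))) μ :=
    (hud i).add (hηd i)
  simp only [hdensity]
  rw [integral_finsetSum _ fun i _ ↦ hsum i]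
  refine Finset.sum_eq_zero fun i _ ↦ ?_
  rw [integral_add (hud i) (hηd i), integral_bilinear_fderiv_right_eq_neg_left_of_integrable
    (hud i) (hηd i) (integrable_pair i hu.continuous hη.continuous hηc)
    (fun x _ ↦ hu.differentiable (by simp) x) (fun x _ ↦ hη.differentiable (by simp) x),
    add_neg_cancel]

end Smooth

section Mollification

variable [FiniteDimensional ℝ E] [MeasurableSpace E] [BorelSpace E] {μ : Measure E}
  [μ.IsAddHaarMeasure] {ρ : E → ℝ}

variable {S} in
theorem IsWeakImage.pairLeft_opLeft_convolution [CompleteSpace X] [CompleteSpace W]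
    (huw : S.IsWeakImage μ univ u w) (hu : LocallyIntegrable u μ) (hw : LocallyIntegrable w μ)
    (hρ : ContDiff ℝ (⊤ : ℕ∞) ρ) (hρc : HasCompactSupport ρ) (x : E) (y : Y) :
    S.pairLeft (S.opLeft (ρ ⋆[lsmul ℝ ℝ, μ] u) x) y =
      S.pairLeft ((ρ ⋆[lsmul ℝ ℝ, μ] w) x) y := by
  have hfderiv := (hρc.hasFDerivAt_convolution_left (lsmul ℝ ℝ (E := X))
    (hρ.of_le (by simp)) hu x).fderiv
  have hexu : ConvolutionExistsAt (fderiv ℝ ρ) u x ((lsmul ℝ ℝ (E := X)).precompL E) μ :=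
    (hρc.fderiv ℝ).convolutionExists_left _ (hρ.continuous_fderiv (by simp)) hu x
  have hexw : ConvolutionExistsAt ρ w x (lsmul ℝ ℝ) μ :=
    hρc.convolutionExists_left _ hρ.continuous hw x
  let L : (E →L[ℝ] X) →L[ℝ] ℝ := (S.pairLeft.flip y).comp S.symbolLeft
  let η : E → Y := fun t ↦ ρ (x - t) • y
  have hfderiv_η (t : E) : fderiv ℝ η t = -(fderiv ℝ ρ (x - t)).smulRight y := by
    have hd : HasFDerivAt η _ t := ((hρ.differentiable (by simp) (x - t)).hasFDerivAt.comp t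
      ((hasFDerivAt_id t).const_sub x)).smul_const y
    rw [hd.fderiv]
    ext
    simp
  have hdensity (t : E) : S.greenDensity u w η (S.opRight η) t =
      S.pairLeft.flip y (lsmul ℝ ℝ (ρ (x - t)) (w t)) -
        L ((lsmul ℝ ℝ).precompL E (fderiv ℝ ρ (x - t)) (u t)) := by
    have hsymbol := S.pair_symbol (fderiv ℝ ρ (x - t)) (u t) y
    have hsmul : S.pairLeft (w t) (ρ (x - t) • y) = S.pairLeft (ρ (x - t) • w t) y := by
      rw [map_smul, map_smul, _root_.smul_apply]
    simp only [greenDensity, opRight, hfderiv_η, map_neg, ← hsymbol, ← sub_eq_add_neg, η, hsmul]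
    rfl
  have hηc : HasCompactSupport η := (hρc.comp_homeomorph (Homeomorph.subLeft x)).smul_right
  have hη := huw η ((hρ.comp (contDiff_const.sub contDiff_id)).smul contDiff_const) hηc
    (subset_univ _)
  simp only [hdensity, setIntegral_univ] at hη
  rw [integral_sub ((S.pairLeft.flip y).integrable_comp hexw.integrable_swap)
    (L.integrable_comp hexu.integrable_swap), ← clm_convolution_apply _ _ hexw,
    ← clm_convolution_apply _ _ hexu, sub_eq_zero, ← hfderiv] at hη
  exact hη.symm

end Mollification

end FirstOrderDuality

end FirstOrder

noncomputable section Green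

open Set Filter Topology ContinuousLinearMap
open scoped Convolution Pointwise

theorem isOpen_setOf_forall_add_mem {E : Type*} [TopologicalSpace E] [Add E] [ContinuousAdd E]
    {K U : Set E} (hK : IsCompact K) (hU : IsOpen U) : IsOpen {z | ∀ y ∈ K, y + z ∈ U} :=
  isOpen_iff_eventually.2 fun _ hz ↦ hK.eventually_forall_of_forall_eventually fun y hy ↦
    (continuous_snd.add continuous_fst).continuousAt.eventually_mem (hU.mem_nhds (hz y hy))

variable {E X Y W Z : Type*} [NormedAddCommGroup E] [NormedSpace ℝ E] [FiniteDimensional ℝ E]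
  [NormedAddCommGroup X] [NormedSpace ℝ X] [NormedAddCommGroup Y] [NormedSpace ℝ Y]
  [NormedAddCommGroup W] [NormedSpace ℝ W] [NormedAddCommGroup Z] [NormedSpace ℝ Z]
  [MeasurableSpace E] [BorelSpace E] {μ : Measure E}

theorem ae_eq_of_forall_integral_bilin_eq [CompleteSpace X] (P : X →L[ℝ] Y →L[ℝ] ℝ)
    (hP : ∀ x, (∀ y, P x y = 0) → x = 0) {U : Set E} (hU : IsOpen U) {w w' : E → X}
    (hw : LocallyIntegrableOn w U μ) (hw' : LocallyIntegrableOn w' U μ)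
    (heq : ∀ η : E → Y, ContDiff ℝ (⊤ : ℕ∞) η → HasCompactSupport η → tsupport η ⊆ U →
      ∫ x in U, P (w x) (η x) ∂μ = ∫ x in U, P (w' x) (η x) ∂μ) : w =ᵐ[μ.restrict U] w' := by
  suffices h : ∀ᵐ x ∂μ, x ∈ U → w x - w' x = 0 by
    filter_upwards [(ae_restrict_iff' hU.measurableSet).2 h] with x hx using sub_eq_zero.1 hx
  refine hU.ae_eq_zero_of_integral_contDiff_smul_eq_zero (hw.sub hw') fun g hg hgc hgU ↦
    hP _ fun y ↦ ?_
  let η : E → Y := fun x ↦ g x • y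
  have hη : ContDiff ℝ (⊤ : ℕ∞) η := hg.smul contDiff_const
  have hηc : HasCompactSupport η := hgc.smul_right
  have hηU : tsupport η ⊆ U := (tsupport_smul_subset_left g _).trans hgU
  have hset (f : E → X) : ∫ x in U, P (f x) (η x) ∂μ = ∫ x, P (f x) (η x) ∂μ :=
    setIntegral_eq_integral_of_forall_compl_eq_zero fun x hx ↦ by
      rw [image_eq_zero_of_notMem_tsupport fun h ↦ hx (hηU h), map_zero]
  have hint : Integrable (fun x ↦ g x • (w x - w' x)) μ :=
    integrable_bilin_of_locallyIntegrableOn (lsmul ℝ ℝ).flip (hw.sub hw') hg.continuous hgc hgU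
  rw [← flip_apply P _ y, ← (P.flip y).integral_comp_comm hint, ← sub_eq_zero.2 (heq η hη hηc hηU),
    hset, hset, ← integral_sub
      (integrable_bilin_of_locallyIntegrableOn P hw hη.continuous hηc hηU)
      (integrable_bilin_of_locallyIntegrableOn P hw' hη.continuous hηc hηU)]
  simp [η, mul_sub]

variable [μ.IsAddHaarMeasure]

theorem eq_zero_of_forall_integral_contDiff_mul_eq_zero {G : E → ℝ} (hG : Continuous G) {V : Set E}
    (hV : IsOpen V)
    (h : ∀ ρ : E → ℝ, ContDiff ℝ (⊤ : ℕ∞) ρ → HasCompactSupport ρ → tsupport ρ ⊆ V →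
      ∫ x, ρ x * G x ∂μ = 0) {z : E} (hz : z ∈ closure V) : G z = 0 := by
  have hae := hV.ae_eq_zero_of_integral_contDiff_smul_eq_zero
    (hG.locallyIntegrable.locallyIntegrableOn V) h
  have hGV : EqOn G 0 V := Measure.eqOn_open_of_ae_eq
    ((ae_restrict_iff' hV.measurableSet).2 hae) hV hG.continuousOn continuousOn_const
  exact hGV.closure hG continuous_const hz

namespace FirstOrderDuality

variable {S : FirstOrderDuality E X Y W Z} {u : E → X} {w : E → W} {D : E → Y} {v : E → Z}
  {p p' q q' : ENNReal} [p.HolderConjugate p'] [q.HolderConjugate q']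

omit [μ.IsAddHaarMeasure] [FiniteDimensional ℝ E] [BorelSpace E] in
theorem integrable_greenDensity (hu : MemLp u p μ) (hw : MemLp w q μ) (hD : MemLp D q' μ)
    (hv : MemLp v p' μ) : Integrable (S.greenDensity u w D v) μ :=
  (integrable_bilin_of_memLp S.pairLeft hw hD).add (integrable_bilin_of_memLp S.pairRight hu hv)

theorem continuous_integral_greenDensity_translate (hu : MemLp u p μ) (hw : MemLp w q μ)
    (hD : MemLp D q' μ) (hv : MemLp v p' μ) :
    Continuous fun z ↦ ∫ x, S.greenDensity u w (fun x ↦ D (x + z)) (fun x ↦ v (x + z)) x ∂μ := by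
  refine ((continuous_integral_bilin_translate S.pairLeft hw hD).add
    (continuous_integral_bilin_translate S.pairRight hu hv)).congr fun z ↦ ?_
  have hshift := measurePreserving_add_right μ z
  exact (integral_add
    (integrable_bilin_of_memLp S.pairLeft hw (hD.comp_measurePreserving hshift))
    (integrable_bilin_of_memLp S.pairRight hu (hv.comp_measurePreserving hshift))).symm

variable [CompleteSpace X] [CompleteSpace W]

theorem integral_greenDensity_convolution (hu : MemLp u p μ) (hw : MemLp w q μ)
    (hD : MemLp D q' μ) (hv : MemLp v p' μ) (huc : HasCompactSupport u)
    (huw : S.IsWeakImage μ univ u w) {ρ : E → ℝ} (hρ : ContDiff ℝ (⊤ : ℕ∞) ρ)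
    (hρc : HasCompactSupport ρ) :
    ∫ x, S.greenDensity (ρ ⋆[lsmul ℝ ℝ, μ] u) (S.opLeft (ρ ⋆[lsmul ℝ ℝ, μ] u)) D v x ∂μ =
      ∫ z, ρ z * ∫ x, S.greenDensity u w (fun x ↦ D (x + z)) (fun x ↦ v (x + z)) x ∂μ ∂μ := by
  have hul : LocallyIntegrable u μ := hu.locallyIntegrable (ENNReal.HolderConjugate.one_le p p')
  have hwl : LocallyIntegrable w μ := hw.locallyIntegrable (ENNReal.HolderConjugate.one_le q q')
  have hDl : LocallyIntegrable D μ := hD.locallyIntegrable (ENNReal.HolderConjugate.one_le q' q)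
  have hvl : LocallyIntegrable v μ := hv.locallyIntegrable (ENNReal.HolderConjugate.one_le p' p)
  have hsmooth := hρc.contDiff_convolution_left (lsmul ℝ ℝ (E := X)) hρ hul
  have hcompact : HasCompactSupport (ρ ⋆[lsmul ℝ ℝ, μ] u) := hρc.convolution _ huc
  have hleft := integrable_bilin_of_locallyIntegrableOn S.pairLeft.flip
    (hDl.locallyIntegrableOn univ) (S.contDiff_opLeft hsmooth).continuous
    (S.hasCompactSupport_opLeft hcompact) (subset_univ _)
  have hright := integrable_bilin_of_locallyIntegrableOn S.pairRight.flip
    (hvl.locallyIntegrableOn univ) hsmooth.continuous hcompact (subset_univ _)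
  have hshift (z : E) := measurePreserving_add_right μ z
  have hmul {F : E → ℝ} (hF : Continuous F) : Integrable (fun z ↦ ρ z * F z) μ :=
    (hρ.continuous.mul hF).integrable_of_hasCompactSupport hρc.mul_right
  have hinner (z : E) := integral_add
    (integrable_bilin_of_memLp S.pairLeft hw (hD.comp_measurePreserving (hshift z)))
    (integrable_bilin_of_memLp S.pairRight hu (hv.comp_measurePreserving (hshift z)))
  simp only [greenDensity, Function.comp_apply] at hinner ⊢
  simp only [hinner, mul_add]
  rw [integral_add (hmul (continuous_integral_bilin_translate S.pairLeft hw hD))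
    (hmul (continuous_integral_bilin_translate S.pairRight hu hv)),
    ← integral_bilin_convolution S.pairLeft hw hD hρ.continuous hρc,
    ← integral_bilin_convolution S.pairRight hu hv hρ.continuous hρc]
  simp only [← huw.pairLeft_opLeft_convolution hul hwl hρ hρc]
  exact integral_add hleft hright

theorem IsWeakImage.integral_greenDensity_eq_zero {K U : Set E} (hK : IsCompact K) (hU : IsOpen U)
    (hKU : (0 : E) ∈ closure {z | ∀ y ∈ K, y + z ∈ U}) (hu : MemLp u p μ) (hw : MemLp w q μ)
    (hD : MemLp D q' μ) (hv : MemLp v p' μ) (huK : Function.support u ⊆ K)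
    (huw : S.IsWeakImage μ univ u w) (hDv : S.flip.IsWeakImage μ U D v) :
    ∫ x, S.greenDensity u w D v x ∂μ = 0 := by
  have huc : HasCompactSupport u := HasCompactSupport.of_support_subset_isCompact hK huK
  suffices h : ∀ ρ : E → ℝ, ContDiff ℝ (⊤ : ℕ∞) ρ → HasCompactSupport ρ →
      tsupport ρ ⊆ {z | ∀ y ∈ K, y + z ∈ U} →
      ∫ z, ρ z * ∫ x, S.greenDensity u w (fun x ↦ D (x + z)) (fun x ↦ v (x + z)) x ∂μ ∂μ = 0 by
    simpa only [add_zero] using eq_zero_of_forall_integral_contDiff_mul_eq_zero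
      (continuous_integral_greenDensity_translate hu hw hD hv)
      (isOpen_setOf_forall_add_mem hK hU) h hKU
  intro ρ hρ hρc hρU
  have hsupport : tsupport (ρ ⋆[lsmul ℝ ℝ, μ] u) ⊆ K + tsupport ρ :=
    closure_minimal ((support_convolution_subset _).trans
      (add_comm K (tsupport ρ) ▸ add_subset_add (subset_tsupport ρ) huK)) (hK.add hρc).isClosed
  have hsupportU : tsupport (ρ ⋆[lsmul ℝ ℝ, μ] u) ⊆ U := by
    refine hsupport.trans ?_
    rintro _ ⟨y, hy, z, hz, rfl⟩
    exact hρU hz y hy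
  rw [← integral_greenDensity_convolution hu hw hD hv huc huw hρ hρc,
    ← S.setIntegral_greenDensity_left hsupportU]
  simpa only [S.greenDensity_flip, S.opRight_flip] using hDv _
    (hρc.contDiff_convolution_left _ hρ
      (hu.locallyIntegrable (ENNReal.HolderConjugate.one_le p p')))
    (hρc.convolution _ huc) hsupportU

end FirstOrderDuality

end Green

noncomputable section Localization

open Set Filter Topology ContinuousLinearMap
open scoped ContDiff Manifold

theorem memLp_restrict_of_continuous {E F : Type*} [PseudoMetricSpace E] [ProperSpace E]
    [MeasurableSpace E] [OpensMeasurableSpace E] {μ : Measure E} [IsFiniteMeasureOnCompacts μ]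
    [NormedAddCommGroup F] {p : ENNReal} {f : E → F} (hf : Continuous f) {U : Set E}
    (hU : Bornology.IsBounded U) : MemLp f p (μ.restrict U) := by
  have : IsFiniteMeasure (μ.restrict (closure U)) :=
    isFiniteMeasure_restrict.2 hU.isCompact_closure.measure_ne_top
  obtain ⟨C, hC⟩ := hU.isCompact_closure.exists_bound_of_continuousOn hf.continuousOn
  exact (MemLp.of_bound hf.aestronglyMeasurable C
    (ae_restrict_of_forall_mem isClosed_closure.measurableSet hC)).mono_measure
    (Measure.restrict_mono_set μ subset_closure)

variable {E X Y W Z : Type*} [NormedAddCommGroup E] [NormedSpace ℝ E] [FiniteDimensional ℝ E]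
  [NormedAddCommGroup X] [NormedSpace ℝ X] [NormedAddCommGroup Y] [NormedSpace ℝ Y]
  [NormedAddCommGroup W] [NormedSpace ℝ W] [NormedAddCommGroup Z] [NormedSpace ℝ Z]

theorem exists_contDiff_partitionOfUnity {K : Set E} (hK : IsCompact K) {N : E → Set E}
    (hN : ∀ x ∈ K, N x ∈ 𝓝 x) : ∃ (s : Finset E) (χ : s → E → ℝ), ↑s ⊆ K ∧
      (∀ i, ContDiff ℝ ∞ (χ i)) ∧ (∀ i : s, tsupport (χ i) ⊆ N i) ∧ ∀ x ∈ K, ∑ i, χ i x = 1 := by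
  obtain ⟨s, hsK, hcover⟩ := hK.elim_nhds_subcover (fun x ↦ interior (N x))
    fun x hx ↦ interior_mem_nhds.2 (hN x hx)
  obtain ⟨χ, hχ⟩ := SmoothPartitionOfUnity.exists_isSubordinate 𝓘(ℝ, E) hK.isClosed
    (fun i : s ↦ interior (N i)) (fun i ↦ isOpen_interior) (by simpa [iUnion_subtype] using hcover)
  refine ⟨s, fun i ↦ χ i, hsK, fun i ↦ (χ i).contMDiff.contDiff,
    fun i ↦ (hχ i).trans interior_subset, fun x hx ↦ ?_⟩
  rw [← finsum_eq_sum_of_fintype]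
  exact χ.sum_eq_one hx

omit [FiniteDimensional ℝ E] in
theorem HasSegmentProperty.exists_nhds_zero_mem_closure {U : Set E} (hseg : HasSegmentProperty U)
    (hU : IsOpen U) {x : E} (hx : x ∈ closure U) :
    ∃ N ∈ 𝓝 x, ∀ K ⊆ closure U ∩ N, (0 : E) ∈ closure {z | ∀ y ∈ K, y + z ∈ U} := by
  obtain ⟨N, hN, ν, hν⟩ := hseg.exists_mapsTo_of_mem_closure hU hx
  refine ⟨N, hN, fun K hK ↦ mem_closure_of_tendsto (tendsto_add_smul_nhdsGT 0 ν) ?_⟩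
  filter_upwards [hν] with t ht y hy
  simpa using ht (hK hy)

variable [MeasurableSpace E] [BorelSpace E] {μ : Measure E}

namespace FirstOrderDuality

variable {S : FirstOrderDuality E X Y W Z} {u : E → X} {w : E → W} {D : E → Y} {v : E → Z}
  {χ : E → ℝ}

section Leibniz

omit [FiniteDimensional ℝ E] [MeasurableSpace E] [BorelSpace E]

theorem greenDensity_leibniz {η : E → Y} {x : E} (hχ : DifferentiableAt ℝ χ x)
    (hη : DifferentiableAt ℝ η x) :
    S.greenDensity (fun x ↦ χ x • u x) (S.leibniz χ u w) η (S.opRight η) x =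
      S.greenDensity u w (fun x ↦ χ x • η x) (S.opRight fun x ↦ χ x • η x) x := by
  simp only [greenDensity, leibniz, opRight, fderiv_fun_smul hχ hη, map_add, map_smul,
    _root_.add_apply, _root_.smul_apply, S.pair_symbol]
  ring

theorem sum_greenDensity_leibniz {ι : Type*} [Fintype ι] {χ : ι → E → ℝ} {x : E}
    (hχ : ∑ i, χ i x = 1) (hdχ : ∑ i, fderiv ℝ (χ i) x = 0) :
    ∑ i, S.greenDensity (fun x ↦ χ i x • u x) (S.leibniz (χ i) u w) D v x =
      S.greenDensity u w D v x := by
  have hsmulRight : ∑ i, (fderiv ℝ (χ i) x).smulRight (u x) = 0 := by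
    ext y
    simp only [_root_.sum_apply, smulRight_apply, ← Finset.sum_smul]
    simp only [← _root_.sum_apply, hdχ, _root_.zero_apply, zero_smul]
  have hleibniz : ∑ i, S.leibniz (χ i) u w x = w x := by
    simp only [leibniz, Finset.sum_add_distrib, ← Finset.sum_smul, hχ, one_smul, ← map_sum,
      hsmulRight, map_zero, add_zero]
  simp only [greenDensity, Finset.sum_add_distrib, ← _root_.sum_apply, ← map_sum, hleibniz,
    ← Finset.sum_smul, hχ, one_smul]

end Leibniz

omit [FiniteDimensional ℝ E] [BorelSpace E] in
theorem HasZeroTrace.leibniz {U : Set E} (huw : S.HasZeroTrace μ U u w) (hχ : ContDiff ℝ ∞ χ) :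
    S.HasZeroTrace μ U (fun x ↦ χ x • u x) (S.leibniz χ u w) := fun η hη ↦ by
  simp only [greenDensity_leibniz (hχ.differentiable (by simp) _) (hη.differentiable (by simp) _)]
  exact huw _ (hχ.smul hη)

variable {p p' q q' : ENNReal} {U : Set E}

theorem memLp_leibniz [IsFiniteMeasureOnCompacts μ] (hqp : q ≤ p) (hU : Bornology.IsBounded U)
    (hu : MemLp u p (μ.restrict U)) (hw : MemLp w q (μ.restrict U)) (hχ : ContDiff ℝ 1 χ) :
    MemLp (S.leibniz χ u w) q (μ.restrict U) := by
  have : IsFiniteMeasure (μ.restrict U) := isFiniteMeasure_restrict.2 hU.measure_lt_top.ne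
  have hχw : MemLp (fun x ↦ χ x • w x) q (μ.restrict U) :=
    hw.smul (memLp_restrict_of_continuous hχ.continuous hU (p := ⊤))
  have hdχu : MemLp (fun x ↦ S.symbolLeft ((fderiv ℝ χ x).smulRight (u x))) q (μ.restrict U) :=
    (compL ℝ X _ W S.symbolLeft ∘L smulRightL ℝ E X).memLp_of_bilin q (p := ⊤)
      (memLp_restrict_of_continuous (hχ.continuous_fderiv one_ne_zero) hU) (hu.mono_exponent hqp)
  exact hχw.add hdχu

variable [μ.IsAddHaarMeasure] [p.HolderConjugate p'] [q.HolderConjugate q'] [CompleteSpace X]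
  [CompleteSpace W]

theorem HasZeroTrace.integral_greenDensity_eq_zero_of_isCompact {K : Set E} (hK : IsCompact K)
    (hU : IsOpen U) (hKU : (0 : E) ∈ closure {z | ∀ y ∈ K, y + z ∈ U})
    (hu : MemLp u p (μ.restrict U)) (hw : MemLp w q (μ.restrict U))
    (hD : MemLp D q' (μ.restrict U)) (hv : MemLp v p' (μ.restrict U))
    (huK : U ∩ Function.support u ⊆ K) (huw : S.HasZeroTrace μ U u w)
    (hDv : S.flip.IsWeakImage μ U D v) : ∫ x in U, S.greenDensity u w D v x ∂μ = 0 := by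
  have hUm := hU.measurableSet
  have huU : MemLp (U.indicator u) p μ := (memLp_indicator_iff_restrict hUm).2 hu
  have hwU : MemLp (U.indicator w) q μ := (memLp_indicator_iff_restrict hUm).2 hw
  have hDU : MemLp (U.indicator D) q' μ := (memLp_indicator_iff_restrict hUm).2 hD
  have hvU : MemLp (U.indicator v) p' μ := (memLp_indicator_iff_restrict hUm).2 hv
  have hsupport : Function.support (U.indicator u) ⊆ K := by rwa [support_indicator]
  rw [← integral_indicator hUm, ← inter_self U, ← indicator_indicator,
    ← greenDensity_indicator_right, ← greenDensity_indicator_left]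
  exact (huw.isWeakImage_univ_indicator hUm).integral_greenDensity_eq_zero hK hU hKU huU hwU hDU
    hvU hsupport (hDv.indicator hUm)

theorem HasZeroTrace.integral_greenDensity_eq_zero (hqp : q ≤ p) (hU : IsOpen U)
    (hUb : Bornology.IsBounded U) (hseg : HasSegmentProperty U)
    (hu : MemLp u p (μ.restrict U)) (hw : MemLp w q (μ.restrict U))
    (hD : MemLp D q' (μ.restrict U)) (hv : MemLp v p' (μ.restrict U))
    (huw : S.HasZeroTrace μ U u w) (hDv : S.flip.IsWeakImage μ U D v) :
    ∫ x in U, S.greenDensity u w D v x ∂μ = 0 := by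
  have hcl : IsCompact (closure U) := hUb.isCompact_closure
  choose! N hN hshift using fun x hx ↦ hseg.exists_nhds_zero_mem_closure hU (x := x) hx
  obtain ⟨s, χ, hs, hχ, hχN, hsum⟩ := exists_contDiff_partitionOfUnity hcl hN
  have hdsum {x : E} (hx : x ∈ U) : ∑ i, fderiv ℝ (χ i) x = 0 := by
    have hone : (fun y ↦ ∑ i, χ i y) =ᶠ[𝓝 x] fun _ ↦ 1 := by
      filter_upwards [hU.mem_nhds hx] with y hy using hsum y (subset_closure hy)
    rw [← fderiv_fun_sum fun i _ ↦ (hχ i).differentiable (by simp) x, hone.fderiv_eq,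
      fderiv_fun_const, Pi.zero_apply]
  have hχu (i : s) : MemLp (fun x ↦ χ i x • u x) p (μ.restrict U) :=
    hu.smul (memLp_restrict_of_continuous (hχ i).continuous hUb (p := ⊤))
  have hleibniz (i : s) : MemLp (S.leibniz (χ i) u w) q (μ.restrict U) :=
    memLp_leibniz hqp hUb hu hw ((hχ i).of_le (by simp))
  have hpiece (i : s) :
      ∫ x in U, S.greenDensity (fun x ↦ χ i x • u x) (S.leibniz (χ i) u w) D v x ∂μ = 0 := by
    refine (huw.leibniz (hχ i)).integral_greenDensity_eq_zero_of_isCompact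
      (hcl.inter_right (isClosed_tsupport (χ i))) hU
      (hshift i (hs i.2) _ (inter_subset_inter_right _ (hχN i))) (hχu i) (hleibniz i) hD hv ?_ hDv
    exact inter_subset_inter subset_closure
      ((Function.support_smul_subset_left _ _).trans (subset_tsupport (χ i)))
  calc ∫ x in U, S.greenDensity u w D v x ∂μ
      = ∫ x in U, ∑ i, S.greenDensity (fun x ↦ χ i x • u x) (S.leibniz (χ i) u w) D v x ∂μ :=
        setIntegral_congr_fun hU.measurableSet fun x hx ↦
          (sum_greenDensity_leibniz (hsum x (subset_closure hx)) (hdsum hx)).symm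
    _ = 0 := by
        rw [integral_finsetSum _ fun i _ ↦ integrable_greenDensity (hχu i) (hleibniz i) hD hv]
        exact Finset.sum_eq_zero fun i _ ↦ hpiece i

end FirstOrderDuality

end Localization

noncomputable section Forms

open Set Filter Topology

variable {n k m : ℕ} {𝔤 : Type*} [NormedAddCommGroup 𝔤] [InnerProductSpace ℝ 𝔤]

variable (𝔤) in
/-- The exterior derivatives of `k`-forms and of `(n-k-1)`-forms, with the pairings
`⟨du ∧ D⟩` and `(-1)ᵏ ⟨u ∧ dD⟩` whose sum is `d⟨u ∧ D⟩`. -/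
def extDerivDuality (h : k + m + 1 = n) : FirstOrderDuality (Space n)
    (Covector n k 𝔤) (Covector n m 𝔤) (Covector n (k + 1) 𝔤) (Covector n (m + 1) 𝔤) where
  symbolLeft := ContinuousAlternatingMap.alternatizeUncurryFinCLM ℝ (Space n) 𝔤
  symbolRight := ContinuousAlternatingMap.alternatizeUncurryFinCLM ℝ (Space n) 𝔤
  pairLeft := wedgeCLM 𝔤 (by omega)
  pairRight := (-1 : ℝ) ^ k • wedgeCLM 𝔤 (by omega)
  pair_symbol := wedgeCoeff_covWedge_left (by omega) (by omega)

theorem contDiff_extDeriv {η : Form n k 𝔤} (hη : ContDiff ℝ (⊤ : ℕ∞) η) :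
    ContDiff ℝ (⊤ : ℕ∞) (extDeriv η) :=
  (ContinuousAlternatingMap.alternatizeUncurryFinCLM ℝ (Space n) 𝔤).contDiff.comp
    (hη.fderiv_right (by simp))

variable {U V : Set (Space n)} {u : Form n k 𝔤} {w w' : Form n (k + 1) 𝔤} {D : Form n m 𝔤}
  {v : Form n (m + 1) 𝔤}

theorem greenDensity_extDerivDuality_comm (h : k + m + 1 = n) (h' : m + k + 1 = n) :
    (extDerivDuality 𝔤 h').greenDensity D v u w =
      fun x ↦ (-1) ^ (k * m) * (extDerivDuality 𝔤 h).greenDensity u w D v x := by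
  ext x
  change wedgeCoeff _ (v x) (u x) + (-1) ^ m * wedgeCoeff _ (D x) (w x) =
    (-1) ^ (k * m) * (wedgeCoeff _ (w x) (D x) + (-1) ^ k * wedgeCoeff _ (u x) (v x))
  rw [wedgeCoeff_comm _ (by omega) (v x), wedgeCoeff_comm _ (by omega) (D x)]
  have hm : ((-1 : ℝ) ^ m) * (-1) ^ m = 1 := by rw [← mul_pow]; simp
  rw [add_mul, mul_add, mul_one, one_mul, pow_add, pow_add, mul_comm m k]
  linear_combination (-1) ^ (k * m) * wedgeCoeff (by omega) (w x) (D x) * hm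

theorem setIntegral_greenDensity_eq_zero_iff (h : k + m + 1 = n) (hu : LocallyIntegrableOn u U)
    (hw : LocallyIntegrableOn w U) {η : Form n m 𝔤} (hη : ContDiff ℝ (⊤ : ℕ∞) η)
    (hηc : HasCompactSupport η) (hηU : tsupport η ⊆ U) :
    ∫ x in U, (extDerivDuality 𝔤 h).greenDensity u w η (extDeriv η) x = 0 ↔
      ∫ x in U, wedgeCoeff (by omega) (w x) (η x) =
        (-1) ^ (k + 1) * ∫ x in U, wedgeCoeff (by omega) (u x) (extDeriv η x) := by
  have hwη : IntegrableOn (fun x ↦ wedgeCoeff (by omega) (w x) (η x)) U :=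
    (integrable_bilin_of_locallyIntegrableOn (wedgeCLM 𝔤 _) hw hη.continuous hηc hηU).integrableOn
  have hudη : IntegrableOn (fun x ↦ (-1) ^ k * wedgeCoeff (by omega) (u x) (extDeriv η x)) U :=
    ((integrable_bilin_of_locallyIntegrableOn (wedgeCLM 𝔤 _) hu
      (contDiff_extDeriv hη).continuous ((extDerivDuality 𝔤 h).flip.hasCompactSupport_opLeft hηc)
      ((extDerivDuality 𝔤 h).flip.tsupport_opLeft_subset.trans hηU)).const_mul _).integrableOn
  have hsum := integral_add hwη hudη
  rw [integral_const_mul] at hsum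
  rw [pow_succ, mul_neg_one, neg_mul, ← add_eq_zero_iff_eq_neg, ← hsum]
  rfl

theorem isWeakExtDeriv_iff : IsWeakExtDeriv U u w ↔
    LocallyIntegrableOn u U ∧ LocallyIntegrableOn w U ∧
      ∀ (m : ℕ) (h : k + m + 1 = n), (extDerivDuality 𝔤 h).IsWeakImage volume U u w :=
  and_congr_right fun hu ↦ and_congr_right fun hw ↦ forall₂_congr fun _ h ↦
    forall₄_congr fun _ hη hηc hηU ↦
      (setIntegral_greenDensity_eq_zero_iff h hu hw hη hηc hηU).symm

theorem IsWeakExtDeriv.isWeakImage_flip (hD : IsWeakExtDeriv U D v) (h : k + m + 1 = n) :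
    (extDerivDuality 𝔤 h).flip.IsWeakImage volume U D v := fun η hη hηc hηU ↦ by
  have hweak := (isWeakExtDeriv_iff.1 hD).2.2 k (by omega) η hη hηc hηU
  rw [greenDensity_extDerivDuality_comm h, integral_const_mul] at hweak
  rw [← FirstOrderDuality.greenDensity_flip]
  exact (mul_eq_zero.1 hweak).resolve_left (pow_ne_zero _ (by norm_num))

theorem isWeakExtDeriv_extDeriv (U : Set (Space n)) (hu : ContDiff ℝ (⊤ : ℕ∞) u) :
    IsWeakExtDeriv U u (extDeriv u) :=
  isWeakExtDeriv_iff.2 ⟨hu.continuous.locallyIntegrable.locallyIntegrableOn U,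
    (contDiff_extDeriv hu).continuous.locallyIntegrable.locallyIntegrableOn U,
    fun _ h ↦ (extDerivDuality 𝔤 h).isWeakImage_opLeft hu⟩

theorem IsWeakExtDeriv.mono (hVU : V ⊆ U) (h : IsWeakExtDeriv U u w) : IsWeakExtDeriv V u w := by
  obtain ⟨hu, hw, hweak⟩ := isWeakExtDeriv_iff.1 h
  exact isWeakExtDeriv_iff.2 ⟨hu.mono_set hVU, hw.mono_set hVU, fun m h ↦ (hweak m h).mono hVU⟩

theorem IsWeakExtDeriv.congr_ae_right (h : IsWeakExtDeriv U u w)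
    (hw : w =ᵐ[volume.restrict U] w') : IsWeakExtDeriv U u w' := by
  refine ⟨h.1, h.2.1.congr hw, fun m hm η hη hηc hηU ↦ ?_⟩
  rw [← h.2.2 m hm η hη hηc hηU]
  refine integral_congr_ae ?_
  filter_upwards [hw] with x hx
  rw [hx]

section Complete

variable [CompleteSpace 𝔤]

theorem IsWeakExtDeriv.ae_eq (hU : IsOpen U) (h : IsWeakExtDeriv U u w)
    (h' : IsWeakExtDeriv U u w') : w =ᵐ[volume.restrict U] w' := by
  obtain hlt | hle := lt_or_ge n (k + 1)
  · exact .of_forall fun x ↦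
      (covector_eq_zero_of_lt hlt _).trans (covector_eq_zero_of_lt hlt _).symm
  · obtain ⟨m, hm⟩ := Nat.exists_eq_add_of_le' hle
    have hkm : k + m + 1 = n := by omega
    exact ae_eq_of_forall_integral_bilin_eq (wedgeCLM 𝔤 (by omega))
      (eq_zero_of_wedgeCoeff_eq_zero _) hU h.2.1 h'.2.1 fun η hη hηc hηU ↦
        (h.2.2 m hkm η hη hηc hηU).trans (h'.2.2 m hkm η hη hηc hηU).symm

theorem IsWeakExtDeriv.weakExtDeriv_ae_eq (hU : IsOpen U) (h : IsWeakExtDeriv U u w) :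
    weakExtDeriv U u =ᵐ[volume.restrict U] w := by
  have hex : ∃ w, IsWeakExtDeriv U u w := ⟨w, h⟩
  rw [weakExtDeriv, dif_pos hex]
  exact hex.choose_spec.ae_eq hU h

theorem boundaryIntegral_eq_setIntegral (h : k + m + 1 = n) (hU : IsOpen U)
    (hu : IsWeakExtDeriv U u w) (hD : IsWeakExtDeriv U D v) :
    boundaryIntegral h U u D = ∫ x in U, (extDerivDuality 𝔤 h).greenDensity u w D v x := by
  refine integral_congr_ae ?_
  filter_upwards [hu.weakExtDeriv_ae_eq hU, hD.weakExtDeriv_ae_eq hU] with x hux hDx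
  rw [hux, hDx]
  rfl

theorem hasZeroTangentialTrace_iff (hU : IsOpen U) (hu : IsWeakExtDeriv U u w) :
    HasZeroTangentialTrace U u ↔
      ∀ (m : ℕ) (h : k + m + 1 = n), (extDerivDuality 𝔤 h).HasZeroTrace volume U u w :=
  forall₂_congr fun _ h ↦ forall₂_congr fun η hη ↦ by
    rw [boundaryIntegral_eq_setIntegral h hU hu (isWeakExtDeriv_extDeriv U hη)]
    rfl

end Complete

end Forms

noncomputable section BrokenForms

open Set Filter Topology

variable {n k m : ℕ} {𝔤 : Type*} [NormedAddCommGroup 𝔤] [InnerProductSpace ℝ 𝔤]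
  {Ω : Set (Space n)} {p q p' q' : ENNReal}

variable (k 𝔤) in
/-- The forms `u ∈ L^p(Ω)` with `d(u|_K) ∈ L^q(K)` for all elements `K`: the common generalization
of `DV⁰` and `DV¹`. -/
def BrokenWSpace (T : Triangulation Ω) (p q : ENNReal) : Set (Form n k 𝔤) :=
  {u | MemLp u p (volume.restrict Ω) ∧ ∀ s ∈ T.cells, ∃ w, IsWeakExtDeriv (cellInterior s) u w ∧
    MemLp w q (volume.restrict (cellInterior s))}

theorem eqOn_sum_indicator {α ι M : Type*} [AddCommMonoid M] {t : Finset ι} {U : ι → Set α}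
    (hU : (t : Set ι).PairwiseDisjoint U) (f : ι → α → M) {i : ι} (hi : i ∈ t) :
    EqOn (fun x ↦ ∑ j ∈ t, (U j).indicator (f j) x) (f i) (U i) := fun _ hx ↦
  (Finset.sum_eq_single_of_mem i hi fun _ hj hji ↦ indicator_of_notMem
    (fun hxj ↦ (hU hi hj hji.symm).le_bot ⟨hx, hxj⟩) _).trans (indicator_of_mem hx _)

theorem memLp_sum_indicator {α ι M : Type*} [MeasurableSpace α] {μ : Measure α}
    [NormedAddCommGroup M] {t : Finset ι} {U : ι → Set α} {f : ι → α → M}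
    (hU : ∀ i ∈ t, MeasurableSet (U i)) (hf : ∀ i ∈ t, MemLp (f i) p (μ.restrict (U i))) :
    MemLp (fun x ↦ ∑ i ∈ t, (U i).indicator (f i) x) p μ :=
  memLp_finsetSum t fun i hi ↦ (memLp_indicator_iff_restrict (hU i hi)).2 (hf i hi)

variable {T : Triangulation Ω} {u : Form n k 𝔤} {w : Form n (k + 1) 𝔤} {D : Form n m 𝔤}
  {v : Form n (m + 1) 𝔤}

theorem exists_isWeakExtDeriv_of_mem_brokenWSpace (hu : u ∈ BrokenWSpace k 𝔤 T p q) :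
    ∃ w, (∀ s ∈ T.cells, IsWeakExtDeriv (cellInterior s) u w) ∧
      MemLp w q (volume.restrict Ω) := by
  choose! w hw hwq using hu.2
  have hmeas (s) : MeasurableSet (cellInterior s : Set (Space n)) :=
    (isOpen_cellInterior s).measurableSet
  have hsum := memLp_sum_indicator (fun s _ ↦ hmeas s) hwq
  refine ⟨_, fun s hs ↦ (hw s hs).congr_ae_right ?_, hsum.restrict Ω⟩
  have heq := eqOn_sum_indicator T.pairwiseDisjoint_cellInterior w hs
  exact (heq.aeEq_restrict (hmeas s)).symm

variable [CompleteSpace 𝔤]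

theorem sum_boundaryIntegral_cellInterior (hΩ : interior (closure Ω) = Ω) (h : k + m + 1 = n)
    (huw : ∀ s ∈ T.cells, IsWeakExtDeriv (cellInterior s) u w) (hDv : IsWeakExtDeriv Ω D v)
    (hint : IntegrableOn ((extDerivDuality 𝔤 h).greenDensity u w D v) Ω) :
    ∑ s ∈ T.cells, boundaryIntegral h (cellInterior s) u D =
      ∫ x in Ω, (extDerivDuality 𝔤 h).greenDensity u w D v x := by
  have hsub {s} (hs : s ∈ T.cells) : cellInterior s ⊆ Ω :=
    (Triangulation.cellInterior_subset_interior_closure hs).trans hΩ.subset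
  rw [← setIntegral_congr_set (T.biUnion_cellInterior_ae_eq hΩ),
    integral_biUnion_finset _ (fun s _ ↦ (isOpen_cellInterior s).measurableSet)
      T.pairwiseDisjoint_cellInterior fun s hs ↦ hint.mono_set (hsub hs)]
  exact Finset.sum_congr rfl fun s hs ↦
    boundaryIntegral_eq_setIntegral h (isOpen_cellInterior s) (huw s hs) (hDv.mono (hsub hs))

theorem mem_wSpace_and_hasZeroTangentialTrace (hΩ : IsOpen Ω) (hp : 1 ≤ p) (hq : 1 ≤ q)
    (hu : MemLp u p (volume.restrict Ω)) (hw : MemLp w q (volume.restrict Ω))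
    (h : ∀ (m : ℕ) (h : k + m + 1 = n), (extDerivDuality 𝔤 h).HasZeroTrace volume Ω u w) :
    u ∈ WSpace n k 𝔤 Ω p q ∧ HasZeroTangentialTrace Ω u := by
  have huw : IsWeakExtDeriv Ω u w := isWeakExtDeriv_iff.2
    ⟨locallyIntegrableOn_of_locallyIntegrable_restrict
      (hu.locallyIntegrable hp),
    locallyIntegrableOn_of_locallyIntegrable_restrict
      (hw.locallyIntegrable hq),
    fun m hm η hη _ _ ↦ h m hm η hη⟩
  exact ⟨⟨hu, w, huw, hw⟩, (hasZeroTangentialTrace_iff hΩ huw).2 h⟩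

variable [p.HolderConjugate p'] [q.HolderConjugate q']

theorem sum_boundaryIntegral_eq_zero (hqp : q ≤ p) (hΩ : IsOpen Ω)
    (hΩb : Bornology.IsBounded Ω) (hseg : HasSegmentProperty Ω) (T : Triangulation Ω)
    (hu : u ∈ WSpace n k 𝔤 Ω p q) (hu₀ : HasZeroTangentialTrace Ω u) (h : k + m + 1 = n)
    (hD : D ∈ WSpace n m 𝔤 Ω q' p') :
    ∑ s ∈ T.cells, boundaryIntegral h (cellInterior s) u D = 0 := by
  obtain ⟨hup, w, huw, hwq⟩ := hu
  obtain ⟨hDq, v, hDv, hvp⟩ := hD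
  have hΩ_eq := hseg.interior_closure hΩ
  rw [sum_boundaryIntegral_cellInterior hΩ_eq h (fun s hs ↦ huw.mono
    ((Triangulation.cellInterior_subset_interior_closure hs).trans hΩ_eq.subset)) hDv
    (FirstOrderDuality.integrable_greenDensity hup hwq hDq hvp)]
  exact ((hasZeroTangentialTrace_iff hΩ huw).1 hu₀ m h).integral_greenDensity_eq_zero hqp hΩ hΩb
    hseg hup hwq hDq hvp (hDv.isWeakImage_flip h)

theorem hasZeroTrace_of_sum_boundaryIntegral_eq_zero (hΩ : interior (closure Ω) = Ω)
    (hΩb : Bornology.IsBounded Ω) (hu : MemLp u p (volume.restrict Ω))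
    (hw : MemLp w q (volume.restrict Ω))
    (huw : ∀ s ∈ T.cells, IsWeakExtDeriv (cellInterior s) u w) (h : k + m + 1 = n)
    (hsum : ∀ D ∈ WSpace n m 𝔤 Ω q' p',
      ∑ s ∈ T.cells, boundaryIntegral h (cellInterior s) u D = 0) :
    (extDerivDuality 𝔤 h).HasZeroTrace volume Ω u w := fun η hη ↦ by
  have hηq : MemLp η q' (volume.restrict Ω) := memLp_restrict_of_continuous hη.continuous hΩb
  have hdηp : MemLp (extDeriv η) p' (volume.restrict Ω) :=
    memLp_restrict_of_continuous (contDiff_extDeriv hη).continuous hΩb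
  have hdη := isWeakExtDeriv_extDeriv Ω hη
  rw [← hsum η ⟨hηq, _, hdη, hdηp⟩]
  exact (sum_boundaryIntegral_cellInterior hΩ h huw hdη
    (FirstOrderDuality.integrable_greenDensity hu hw hηq hdηp)).symm

end BrokenForms

theorem holderConjugate_four : ENNReal.HolderConjugate 4 (4 / 3) := by
  rw [ENNReal.holderConjugate_iff, ENNReal.inv_div (by simp) (by simp), ← one_div,
    ← ENNReal.add_div]
  norm_num
  exact ENNReal.div_self (by simp) (by simp)

end YangMills

open YangMills in
theorem mainTheorem4_general {n k : ℕ} {𝔤 : Type*} [NormedAddCommGroup 𝔤] [InnerProductSpace ℝ 𝔤]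
    [CompleteSpace 𝔤] {p p' q q' : ENNReal} [p.HolderConjugate p'] [q.HolderConjugate q']
    (hqp : q ≤ p) {Ω : Set (Space n)} (hΩ : IsOpen Ω) (hΩb : Bornology.IsBounded Ω)
    (hseg : HasSegmentProperty Ω) (T : Triangulation Ω) {u : Form n k 𝔤}
    (hu : u ∈ BrokenWSpace k 𝔤 T p q) :
    (u ∈ WSpace n k 𝔤 Ω p q ∧ HasZeroTangentialTrace Ω u) ↔
      ∀ (m : ℕ) (h : k + m + 1 = n), ∀ D ∈ WSpace n m 𝔤 Ω q' p',
        ∑ s ∈ T.cells, boundaryIntegral h (cellInterior s) u D = 0 := by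
  refine ⟨fun ⟨huW, hu₀⟩ m h D hD ↦
    sum_boundaryIntegral_eq_zero hqp hΩ hΩb hseg T huW hu₀ h hD, fun hsum ↦ ?_⟩
  obtain ⟨w, huw, hw⟩ := exists_isWeakExtDeriv_of_mem_brokenWSpace hu
  exact mem_wSpace_and_hasZeroTangentialTrace hΩ (ENNReal.HolderConjugate.one_le p p')
    (ENNReal.HolderConjugate.one_le q q') hu.1 hw fun m h ↦
      hasZeroTrace_of_sum_boundaryIntegral_eq_zero (hseg.interior_closure hΩ) hΩb hu.1 hw huw h
        (hsum m h)

theorem mainTheorem4 {n : ℕ} {𝔤 : Type*} [NormedAddCommGroup 𝔤] [InnerProductSpace ℝ 𝔤]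
    [FiniteDimensional ℝ 𝔤] (Ω : Set (YangMills.Space n)) (hΩ : YangMills.IsLipschitzDomain Ω)
    (T : YangMills.Triangulation Ω) :
    (∀ φ ∈ YangMills.DV0 𝔤 T,
      (φ ∈ YangMills.V0Ring 𝔤 Ω ↔
        ∀ (m : ℕ) (h : 0 + m + 1 = n), ∀ D ∈ YangMills.VHatD 𝔤 Ω m,
          ∑ s ∈ T.cells, YangMills.boundaryIntegral h (YangMills.cellInterior s) φ D = 0)) ∧
    (∀ A ∈ YangMills.DV1 𝔤 T,
      (A ∈ YangMills.V1Ring 𝔤 Ω ↔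
        ∀ (m : ℕ) (h : 1 + m + 1 = n), ∀ H ∈ YangMills.VHatH 𝔤 Ω m,
          ∑ s ∈ T.cells, YangMills.boundaryIntegral h (YangMills.cellInterior s) A H = 0)) := by
  have : CompleteSpace 𝔤 := FiniteDimensional.complete ℝ 𝔤
  have : ENNReal.HolderConjugate 4 (4 / 3) := YangMills.holderConjugate_four
  exact ⟨fun φ hφ ↦ mainTheorem4_general le_top hΩ.isOpen hΩ.isBounded hΩ.hasSegmentProperty T hφ,
    fun A hA ↦ mainTheorem4_general (by norm_num) hΩ.isOpen hΩ.isBounded hΩ.hasSegmentProperty T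
      hA⟩
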